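/- Let $p$ be an odd prime. For $z$ in the upper half plane $\mathcal H$ put $q=e^{2\pi i z}$, $\theta(z)=\sum_{n\in\mathbb Z}q^{n^2}$, $\varphi(z)=\theta(z)-\theta((z+2)/4)=\sum_{k\ \mathrm{odd}}q^{k^2/4}$, and $M=\theta^2$, $N=2\theta\varphi$, $P=\varphi^2$. For an integral matrix $\alpha=\begin{pmatrix}a&b\\c&d\end{pmatrix}$ with positive determinant let $(f|\alpha)(z)=f\bigl(\tfrac{az+b}{cz+d}\bigr)(cz+d)^{-1}$. Let $V$ be the complex span of all $f|\alpha$ with $f\in\{M,N,P\}$ and $\alpha$ an integral matrix of determinant $1$ or $p$. Let $\Gamma_\pm(4p)=\{\beta\in\Gamma(4):\beta\equiv\pm1 \pmod p\}$, and let $X_\pm(4p)$ be the modular curve obtained from $\Gamma_\pm(4p)\backslash\mathcal H$ by adding the cusps. Let $S$ consist of the identity matrix and the matrices $\begin{pmatrix}1&b\\0&p\end{pmatrix}$, $0\le b<p$, and let $F(z)$ be the point of $\mathbb P^{3(p+1)-1}(\mathbb C)$ whose homogeneous coordinates are the values $(f|\alpha)(z)$, for $f\in\{M,N,P\}$ and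 $\alpha\in S$. Theorem 3.2. The elements of $V$ are modular forms of weight $1$ on $\Gamma_\pm(4p)$, the coordinates of $F$ have no common zero on $\mathcal H$, and the following hold. (1) For every point $x\in X_\pm(4p)$, cusps included, there is an element of $V$ that vanishes at $x$ to order exactly $1$; that is, $V$ separates tangent vectors on $X_\pm(4p)$. (At a noncuspidal point the order is taken with respect to the variable $z$; at a cusp $\gamma\infty$ of width $h$, with $\gamma\in SL(2,\mathbb Z)$, the order of $g$ is that of $g|\gamma$ with respect to $e^{2\pi i z/h}$.) (2) If $z,z'\in\mathcal H$ satisfy $F(z)=F(z')$, then $z'=\beta z$ for some $\beta\in\Gamma_\pm(4p)$. Moreover the elements of $V$ separate the noncuspidal points of $X_\pm(4p)$: if $z,z'\in\mathcal H$ represent different points of $X_\pm(4p)$, then some $g\in V$ has $g(z)=0\ne g(z')$. Hence $F$ factors through an injective map from the set $\Gamma_\pm(4p)\backslash\mathcal H$ of noncuspidal points of $X_\pm(4p)$ to projective space, and this map is an embedding: it is a holomorphic immersion and a homeomorphism onto its image. -/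

import Mathlib

open UpperHalfPlane ModularForm CongruenceSubgroup Matrix.SpecialLinearGroup
open scoped MatrixGroups Pointwise LinearAlgebra.Projectivization Topology Manifold

noncomputable section

namespace WeightOne

/-! ### The weight one forms `M`, `N`, `P` on `Γ(4)` -/

/-- `θ(z) = ∑_{n ∈ ℤ} q ^ (n ^ 2)`, with `q = exp (2 π i z)`. -/
def theta (z : ℂ) : ℂ :=
  ∑' n : ℤ, Complex.exp (2 * Real.pi * Complex.I * (n : ℂ) ^ 2 * z)

/-- `φ(z) = θ(z) - θ((z + 2) / 4)`, that is, the sum of `q ^ (k ^ 2 / 4)` over odd integers `k`. -/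
def phi (z : ℂ) : ℂ := theta z - theta ((z + 2) / 4)

/-- The three forms `M = θ ^ 2`, `N = 2 θ φ`, `P = φ ^ 2`, in this order. -/
def baseForm : Fin 3 → ℂ → ℂ :=
  ![fun z => theta z ^ 2, fun z => 2 * theta z * phi z, fun z => phi z ^ 2]

/-- `(f | α)(z) = f ((a z + b) / (c z + d)) (c z + d)⁻¹` for an integral matrix
`α = (a, b; c, d)`. It is only used for `α` of positive determinant. -/
def slashOne (f : ℂ → ℂ) (α : Matrix (Fin 2) (Fin 2) ℤ) (z : ℍ) : ℂ :=
  f (((α 0 0 : ℂ) * z + α 0 1) / ((α 1 0 : ℂ) * z + α 1 1)) * ((α 1 0 : ℂ) * z + α 1 1)⁻¹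

/-- The space `V`, spanned by the forms `f | α` with `f ∈ {M, N, P}` and `α` an integral matrix
of determinant `1` or `p`. -/
def V (p : ℕ) : Submodule ℂ (ℍ → ℂ) :=
  Submodule.span ℂ {g | ∃ (i : Fin 3) (α : Matrix (Fin 2) (Fin 2) ℤ),
    (α.det = 1 ∨ α.det = p) ∧ g = slashOne (baseForm i) α}

/-! ### The group `Γ_±(4p)` and its modular curve -/

/-- `Γ_±(4p)`: the matrices in `Γ(4)` that are congruent to `1` or `-1` modulo `p`. -/
def GammaPM (p : ℕ) : Subgroup SL(2, ℤ) where
  carrier := {β | β ∈ Gamma 4 ∧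
    (map (Int.castRingHom (ZMod p)) β = 1 ∨ map (Int.castRingHom (ZMod p)) β = -1)}
  one_mem' := ⟨one_mem _, Or.inl (map_one _)⟩
  mul_mem' := by
    rintro a b ⟨ha, ha'⟩ ⟨hb, hb'⟩
    refine ⟨mul_mem ha hb, ?_⟩
    rw [map_mul]
    rcases ha' with h | h <;> rcases hb' with h' | h' <;> simp [h, h']
  inv_mem' := by
    rintro a ⟨ha, ha'⟩
    refine ⟨inv_mem ha, ?_⟩
    rw [map_inv]
    rcases ha' with h | h <;> simp [h, inv_neg]

/-- The image of `Γ_±(4p)` in `GL(2, ℝ)`. -/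
abbrev GammaPMReal (p : ℕ) : Subgroup (GL (Fin 2) ℝ) := (GammaPM p).map (mapGL ℝ)

/-- The noncuspidal points of `X_±(4p)`: the quotient `Γ_±(4p) \ ℍ`. -/
abbrev OpenCurve (p : ℕ) : Type := MulAction.orbitRel.Quotient (GammaPMReal p) ℍ

/-- The noncuspidal point of `X_±(4p)` represented by `z`. -/
def toOpenCurve (p : ℕ) (z : ℍ) : OpenCurve p := Quotient.mk _ z

/-- The points of `X_±(4p)`: the noncuspidal points, and the orbits of cusps. -/
abbrev Curve (p : ℕ) : Type := OpenCurve p ⊕ CuspOrbits (GammaPMReal p)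

/-- The width at `∞` of the conjugate `γ⁻¹ Γ_±(4p) γ`, that is, the width of the cusp `γ ∞`. -/
def cuspWidth (p : ℕ) (γ : SL(2, ℤ)) : ℝ :=
  (ConjAct.toConjAct (mapGL ℝ γ)⁻¹ • GammaPMReal p).widthInfty

/-- `g` vanishes at the point `x` of `X_±(4p)` to order exactly `n`, where `g` is a form of
weight one on `Γ_±(4p)`.

At a noncuspidal point `x` represented by `z : ℍ` this is the order at `z` of `g`, regarded as a
function of a complex variable (`Γ_±(4p)`, being contained in `Γ(4)`, acts freely on `ℍ`,
so `z` is a local coordinate on the curve).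

At a cusp `x` represented by `γ ∞`, with `γ` in `SL(2, ℤ)`, it is the order at `q_h = 0` of
`g ∣[1] γ` regarded as a function of `q_h = exp (2 π i z / h)`, where `h` is the width of the
cusp. -/
def VanishesToOrder (p : ℕ) (g : ℍ → ℂ) (n : ℕ) : Curve p → Prop
  | Sum.inl y => ∀ z : ℍ, toOpenCurve p z = y → analyticOrderAt (g ∘ ofComplex) (z : ℂ) = n
  | Sum.inr c => ∀ (γ : SL(2, ℤ)) (hγ : mapGL ℝ γ • OnePoint.infty ∈
        cuspsSubMulAction (GammaPMReal p)),
      (Quotient.mk _ ⟨mapGL ℝ γ • OnePoint.infty, hγ⟩ : CuspOrbits (GammaPMReal p)) = c →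
      analyticOrderAt (cuspFunction (cuspWidth p γ) (g ∣[(1 : ℤ)] γ)) 0 = n

/-! ### The map `F` to projective space -/

/-- The set `S`, consisting of the identity matrix (at `none`) and the matrices `(1, b; 0, p)`
with `0 ≤ b < p` (at `some b`). -/
def matS (p : ℕ) : Option (Fin p) → Matrix (Fin 2) (Fin 2) ℤ
  | none => 1
  | some b => !![1, (b : ℤ); 0, (p : ℤ)]

/-- The index set of the homogeneous coordinates of `F`. -/
abbrev Idx (p : ℕ) : Type := Fin 3 × Option (Fin p)

/-- The homogeneous coordinates of `F(z)`: the values at `z` of all the forms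
`M | α`, `N | α`, `P | α` with `α ∈ S`. -/
def coords (p : ℕ) (z : ℍ) : Idx p → ℂ := fun i => slashOne (baseForm i.1) (matS p i.2) z

/-- The map `F` from `ℍ` to projective space, given that its coordinates have no common zero. -/
def F (p : ℕ) (h : ∀ z, coords p z ≠ 0) (z : ℍ) : ℙ ℂ (Idx p → ℂ) :=
  Projectivization.mk ℂ (coords p z) (h z)

/-- The topology on complex projective space, as a quotient of the space of nonzero vectors. -/
instance projTopology (ι : Type) : TopologicalSpace (ℙ ℂ (ι → ℂ)) :=
  TopologicalSpace.coinduced (Projectivization.mk' ℂ) inferInstance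

/-- The map to projective space with homogeneous coordinates `f` is holomorphic, and its
differential is nonzero at every point of `ℍ`: near each point, in some affine chart `x_i ≠ 0` of
the projective space, some affine coordinate `x_j / x_i` has nonzero derivative. -/
def IsHolomorphicImmersion {ι : Type} (f : ℍ → ι → ℂ) : Prop :=
  (∀ i, MDiff (fun z => f z i)) ∧
  ∀ z : ℍ, ∃ i j, f z i ≠ 0 ∧
    deriv (fun w : ℂ => f (ofComplex w) j / f (ofComplex w) i) (z : ℂ) ≠ 0

end WeightOne

end

open WeightOne

namespace WeightOne

open Filter Real

/-! ### Theta functions -/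

/-! Everything rests on the function r = φ/θ (`hauptmodul`). The product θφ(θ⁴ - φ⁴) has weight 3
and is invariant under SL(2, ℤ) up to fourth roots of unity. Its fourth power is a nonzero multiple
of the discriminant, so θ has no zeros and r omits 0 and the fourth roots of unity
(`thetaProd_ne_zero`). The quotient of r' by θ⁴ r (1 - r⁴) is a level one form of weight 0, hence a
constant, and the constant is not 0 because r is not constant. So r' has no zeros
(`deriv_hauptmodul_ne_zero`).

Next, r separates the orbits of Γ(4) (`exists_smul_eq_of_hauptmodul_eq`). The values taken at
inequivalent points form an open set, since r is a local homeomorphism. This set is also closed in ℂ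
minus the five omitted values, since r is proper modulo Γ(4). That domain is connected, and values
near 0 are taken on one orbit only, so the set is empty.

The squares of the theta constants are permuted by SL(2, ℤ) up to constants and fixed by Γ(4), so M,
N, P are forms on Γ(4). For β in Γ_±(4p) and det α = 1 or p, the matrix αβα⁻¹ lies in Γ(4)
(`exists_mul_eq_mul`), so V consists of forms on Γ_±(4p). Conversely, if F(z) = F(w), then r gives w
= γz with γ in Γ(4), and likewise (w+n)/p = δ((z+n)/p) for 0 ≤ n < p. The common scalar between the
coordinate vectors makes the factors of automorphy of γ and δ equal. Comparing numerators, p divides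
b + n(d-a) - n²c for these n, so γ ≡ ±1 mod p (`exists_smul_eq_of_coords_eq`).

Simple zeros come from 2r(z₀)M - N = 2θ²(r(z₀) - r) at z₀, and at the cusp γ∞, of width 4p, from N |
diag(1, p)γ⁻¹, since N(z/p) starts with 4q^{1/(4p)}. For the embedding, nearby coordinates give
nearby values of r; openness of r and finiteness of the index leave finitely many translates of w to
separate (`eventually_mem_of_affineCoords`). -/

lemma theta_eq_jacobiTheta (z : ℂ) : theta z = jacobiTheta (2 * z) := by
  unfold theta jacobiTheta
  refine tsum_congr fun n => ?_
  congr 1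
  ring

lemma summable_jacobiTheta_term {w : ℂ} (hw : 0 < w.im) :
    Summable fun n : ℤ => Complex.exp (π * Complex.I * (n : ℂ) ^ 2 * w) := by
  simpa [jacobiTheta₂_term] using (summable_jacobiTheta₂_term_iff 0 w).mpr hw

/-- The shift by 1 multiplies the n-th term by (-1)^n, so only even n survive. This makes θ and φ
the even and odd parts of the series of `jacobiTheta` at z/2. -/
lemma jacobiTheta_add_jacobiTheta_add_one {w : ℂ} (hw : 0 < w.im) :
    jacobiTheta w + jacobiTheta (w + 1) = 2 * jacobiTheta (4 * w) := by
  have hw1 : 0 < (w + 1).im := by simpa using hw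
  unfold jacobiTheta
  rw [← (summable_jacobiTheta_term hw).tsum_add (summable_jacobiTheta_term hw1), ← tsum_mul_left]
  have hinj : Function.Injective fun m : ℤ => 2 * m := fun a b h => by simpa using h
  rw [← hinj.tsum_eq]
  · refine tsum_congr fun m => ?_
    have h1 : Complex.exp (π * Complex.I * ((2 * m : ℤ) : ℂ) ^ 2 * (w + 1))
        = Complex.exp (π * Complex.I * ((2 * m : ℤ) : ℂ) ^ 2 * w) := by
      rw [Complex.exp_eq_exp_iff_exists_int]
      exact ⟨2 * m ^ 2, by push_cast; ring⟩
    rw [h1, ← two_mul]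
    congr 2
    push_cast
    ring
  · intro n hn
    rcases Int.even_or_odd' n with ⟨m, rfl | rfl⟩
    · exact ⟨m, rfl⟩
    · exfalso
      apply hn
      have h1 : Complex.exp (π * Complex.I * ((2 * m + 1 : ℤ) : ℂ) ^ 2 * (w + 1))
          = Complex.exp (π * Complex.I * ((2 * m + 1 : ℤ) : ℂ) ^ 2 * w + π * Complex.I) := by
        rw [Complex.exp_eq_exp_iff_exists_int]
        exact ⟨2 * m ^ 2 + 2 * m, by push_cast; ring⟩
      simp only
      rw [h1, Complex.exp_add, Complex.exp_pi_mul_I]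
      ring

lemma phi_eq_sub (z : ℂ) : phi z = jacobiTheta (2 * z) - jacobiTheta (z / 2 + 1) := by
  rw [phi, theta_eq_jacobiTheta, theta_eq_jacobiTheta]
  congr 2
  ring

lemma two_mul_phi {z : ℂ} (hz : 0 < z.im) :
    2 * phi z = jacobiTheta (z / 2) - jacobiTheta (z / 2 + 1) := by
  have h := jacobiTheta_add_jacobiTheta_add_one (w := z / 2) (by simpa using hz)
  rw [phi_eq_sub, show 2 * z = 4 * (z / 2) by ring]
  linear_combination -h

lemma jacobiTheta_half {z : ℂ} (hz : 0 < z.im) : jacobiTheta (z / 2) = theta z + phi z := by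
  have h := jacobiTheta_add_jacobiTheta_add_one (w := z / 2) (by simpa using hz)
  rw [phi_eq_sub, theta_eq_jacobiTheta, show 2 * z = 4 * (z / 2) by ring]
  linear_combination h

lemma theta_add_one (z : ℂ) : theta (z + 1) = theta z := by
  rw [theta_eq_jacobiTheta, theta_eq_jacobiTheta, mul_add, mul_one, add_comm, jacobiTheta_two_add]

/-- Only the exponents k²/4 with k odd occur in φ, and k² ≡ 1 mod 4. -/
lemma phi_add_one {z : ℂ} (hz : 0 < z.im) : phi (z + 1) = Complex.I * phi z := by
  have hodd : ∀ w : ℂ, 0 < w.im → jacobiTheta w - jacobiTheta (w + 1) =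
      2 * ∑' m : ℤ, Complex.exp (π * Complex.I * ((2 * m + 1 : ℤ) : ℂ) ^ 2 * w) := by
    intro w hw
    have hw1 : 0 < (w + 1).im := by simpa using hw
    unfold jacobiTheta
    rw [← (summable_jacobiTheta_term hw).tsum_sub (summable_jacobiTheta_term hw1), ← tsum_mul_left]
    have hinj : Function.Injective fun m : ℤ => 2 * m + 1 := fun a b h => by simpa using h
    rw [← hinj.tsum_eq]
    · refine tsum_congr fun m => ?_
      have h1 : Complex.exp (π * Complex.I * ((2 * m + 1 : ℤ) : ℂ) ^ 2 * (w + 1))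
          = Complex.exp (π * Complex.I * ((2 * m + 1 : ℤ) : ℂ) ^ 2 * w + π * Complex.I) := by
        rw [Complex.exp_eq_exp_iff_exists_int]
        exact ⟨2 * m ^ 2 + 2 * m, by push_cast; ring⟩
      rw [h1, Complex.exp_add, Complex.exp_pi_mul_I]
      ring
    · intro n hn
      rcases Int.even_or_odd' n with ⟨m, rfl | rfl⟩
      · exfalso
        apply hn
        have h1 : Complex.exp (π * Complex.I * ((2 * m : ℤ) : ℂ) ^ 2 * (w + 1))
            = Complex.exp (π * Complex.I * ((2 * m : ℤ) : ℂ) ^ 2 * w) := by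
          rw [Complex.exp_eq_exp_iff_exists_int]
          exact ⟨2 * m ^ 2, by push_cast; ring⟩
        simp only
        rw [h1, sub_self]
      · exact ⟨m, rfl⟩
  have h2 : (2 : ℂ) ≠ 0 := two_ne_zero
  apply mul_left_cancel₀ h2
  have e : 2 * (Complex.I * phi z) = Complex.I * (2 * phi z) := by ring
  rw [e, two_mul_phi hz, two_mul_phi (by simpa using hz), hodd _ (by simpa using hz),
    hodd _ (by simpa using hz), mul_left_comm, ← tsum_mul_left (a := Complex.I)]
  congr 1
  refine tsum_congr fun m => ?_
  have hI : Complex.I = Complex.exp (π / 2 * Complex.I) := by rw [Complex.exp_pi_div_two_mul_I]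
  conv_rhs => rw [hI]
  rw [← Complex.exp_add, Complex.exp_eq_exp_iff_exists_int]
  -- (2m+1)²/4 = 1/4 + m(m+1).
  refine ⟨m * (m + 1), ?_⟩
  push_cast
  rw [← hI]
  ring

/-- The factor of automorphy of `θ` and `φ` under `z ↦ -1/z`. -/
noncomputable def thetaFactor (z : ℂ) : ℂ := (-Complex.I * (z / 2)) ^ (1 / 2 : ℂ)

lemma thetaFactor_sq (z : ℂ) : thetaFactor z ^ 2 = -Complex.I * (z / 2) := by
  rw [thetaFactor, one_div, ← Nat.cast_ofNat, Complex.cpow_nat_inv_pow _ two_ne_zero]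

lemma im_neg_inv_pos {z : ℂ} (hz : 0 < z.im) : 0 < (-1 / z).im := by
  have := im_inv_neg_coe_pos ⟨z, hz⟩
  simpa [neg_div, ← inv_neg] using this

lemma theta_neg_inv {z : ℂ} (hz : 0 < z.im) :
    theta (-1 / z) = thetaFactor z * (theta z + phi z) := by
  have hz0 : z ≠ 0 := fun h => by simp [h] at hz
  have hz2 : 0 < (z / 2).im := by simpa using hz
  have h := jacobiTheta_S_smul ⟨z / 2, hz2⟩
  rw [modular_S_smul] at h
  rw [theta_eq_jacobiTheta, ← jacobiTheta_half hz, thetaFactor, ← h]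
  congr 1
  simp
  field_simp

/-- Both square roots are principal roots of numbers in the right half plane, so the logarithms add;
the product of the two numbers is 1/4. -/
lemma thetaFactor_mul_thetaFactor_neg_inv {z : ℂ} (hz : 0 < z.im) :
    thetaFactor z * thetaFactor (-1 / z) = 1 / 2 := by
  have hz0 : z ≠ 0 := fun h => by simp [h] at hz
  unfold thetaFactor
  have ha : 0 < (-Complex.I * (z / 2)).re := by simpa using hz
  have hb : 0 < (-Complex.I * (-1 / z / 2)).re := by simpa using im_neg_inv_pos hz
  have haa := (Complex.abs_arg_lt_pi_div_two_iff (z := -Complex.I * (z / 2))).mpr (Or.inl ha)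
  have hbb := (Complex.abs_arg_lt_pi_div_two_iff (z := -Complex.I * (-1 / z / 2))).mpr (Or.inl hb)
  rw [abs_lt] at haa hbb
  have hx : -Complex.I * (z / 2) ≠ 0 := fun h => by simp [h] at ha
  have hy : -Complex.I * (-1 / z / 2) ≠ 0 := fun h => by simp [h] at hb
  rw [Complex.cpow_def_of_ne_zero hx, Complex.cpow_def_of_ne_zero hy, ← Complex.exp_add,
    ← add_mul, ← Complex.log_mul hx hy (by constructor <;> linarith [haa.1, haa.2, hbb.1, hbb.2])]
  have : -Complex.I * (z / 2) * (-Complex.I * (-1 / z / 2)) = ((1 / 4 : ℝ) : ℂ) := by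
    have := Complex.I_sq
    push_cast
    field_simp
    linear_combination -4 * this
  rw [this, ← Complex.ofReal_log (by norm_num), show (1 / 4 : ℝ) = (1 / 2) ^ 2 by norm_num,
    Real.log_pow, show ((((2 : ℕ) : ℝ) * Real.log (1 / 2) : ℝ) : ℂ) * (1 / 2) =
      ((Real.log (1 / 2) : ℝ) : ℂ) by push_cast; ring, ← Complex.ofReal_exp,
    Real.exp_log (by norm_num)]
  push_cast
  rfl

/-- No new summation is needed: the inversion formula of θ, applied at both z and -1/z, can be
solved for φ(-1/z). -/
lemma phi_neg_inv {z : ℂ} (hz : 0 < z.im) :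
    phi (-1 / z) = thetaFactor z * (theta z - phi z) := by
  have hz0 : z ≠ 0 := fun h => by simp [h] at hz
  have h1 := theta_neg_inv (im_neg_inv_pos hz)
  have h2 := theta_neg_inv hz
  have h3 := thetaFactor_mul_thetaFactor_neg_inv hz
  rw [show -1 / (-1 / z) = z by field_simp] at h1
  linear_combination -2 * thetaFactor z * h1 - h2 - 2 * (theta (-1 / z) + phi (-1/z)) * h3

lemma differentiableAt_theta {z : ℂ} (hz : 0 < z.im) : DifferentiableAt ℂ theta z := by
  have : theta = fun z => jacobiTheta (2 * z) := funext theta_eq_jacobiTheta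
  rw [this]
  exact (differentiableAt_jacobiTheta (τ := 2 * z) (by simpa using hz)).comp z
    (f := fun z : ℂ => 2 * z) (by fun_prop)

lemma differentiableAt_phi {z : ℂ} (hz : 0 < z.im) : DifferentiableAt ℂ phi z := by
  have : DifferentiableAt ℂ (fun z : ℂ => theta ((z + 2) / 4)) z :=
    (differentiableAt_theta (z := (z + 2) / 4) (by simpa using hz)).comp z
      (f := fun z : ℂ => (z + 2) / 4) (by fun_prop)
  exact (differentiableAt_theta hz).sub this

/-! ### Behaviour at `i∞` -/

/-- Beyond the first two terms the series is dominated by a geometric one. The quadratic order of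
the error is what yields the leading coefficient of φ. -/
lemma norm_jacobiTheta_sub_le {w : ℂ} (hw : 0 < w.im) :
    ‖jacobiTheta w - 1 - 2 * Complex.exp (π * Complex.I * w)‖ ≤
      2 * (rexp (-π * w.im) ^ 2 / (1 - rexp (-π * w.im))) := by
  set y := rexp (-π * w.im) with hy
  have hy1 : y < 1 := Real.exp_lt_one_iff.mpr (by nlinarith [pi_pos])
  have hs := hasSum_nat_jacobiTheta hw
  rw [← hasSum_nat_add_iff' 1] at hs
  have hb : ∀ n : ℕ, ‖Complex.exp (π * Complex.I * (((n + 1 : ℕ) : ℂ) + 1) ^ 2 * w)‖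
      ≤ y ^ 2 * y ^ n := by
    intro n
    have := norm_exp_mul_sq_le hw (n + 2)
    rw [← pow_add, add_comm 2 n]
    convert! this using 1
    push_cast
    ring_nf
  have hg : HasSum (fun n : ℕ => y ^ 2 * y ^ n) (y ^ 2 * (1 - y)⁻¹) :=
    (hasSum_geometric_of_lt_one (exp_pos _).le hy1).mul_left _
  have := hs.norm_le_of_bounded hg hb
  have e : jacobiTheta w - 1 - 2 * Complex.exp (π * Complex.I * w) =
      2 * ((jacobiTheta w - 1) / 2 - ∑ i ∈ Finset.range 1,
        Complex.exp (π * Complex.I * ((i : ℂ) + 1) ^ 2 * w)) := by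
    simp
    ring
  rw [e, norm_mul, Complex.norm_two, div_eq_mul_inv (y ^ 2)]
  gcongr

lemma norm_phi_sub_le {z : ℂ} (hz : 0 < z.im) :
    ‖phi z - 2 * Complex.exp (π * Complex.I * z / 2)‖ ≤
      2 * (rexp (-π * (z.im / 2)) ^ 2 / (1 - rexp (-π * (z.im / 2)))) := by
  have hw : 0 < (z / 2).im := by simpa using hz
  have h1 := norm_jacobiTheta_sub_le hw
  have h2 := norm_jacobiTheta_sub_le (w := z / 2 + 1) (by simpa using hz)
  have hexp : Complex.exp (π * Complex.I * (z / 2 + 1)) =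
      -Complex.exp (π * Complex.I * (z / 2)) := by
    rw [mul_add, mul_one, Complex.exp_add, Complex.exp_pi_mul_I]
    ring
  rw [hexp] at h2
  have him : (z / 2 + 1).im = z.im / 2 := by simp
  have him' : (z / 2).im = z.im / 2 := by simp
  rw [him] at h2
  rw [him'] at h1
  have e : phi z - 2 * Complex.exp (π * Complex.I * z / 2) =
    ((jacobiTheta (z / 2) - 1 - 2 * Complex.exp (π * Complex.I * (z / 2))) -
      (jacobiTheta (z / 2 + 1) - 1 - 2 * -Complex.exp (π * Complex.I * (z / 2)))) / 2 := by
    have := two_mul_phi hz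
    rw [mul_div_assoc]
    linear_combination this / 2
  rw [e, norm_div, Complex.norm_two]
  have := norm_sub_le (jacobiTheta (z / 2) - 1 - 2 * Complex.exp (π * Complex.I * (z / 2)))
      (jacobiTheta (z / 2 + 1) - 1 - 2 * -Complex.exp (π * Complex.I * (z / 2)))
  linarith

lemma tendsto_exp_neg_mul_im {c : ℝ} (hc : 0 < c) :
    Tendsto (fun z : ℍ => rexp (-c * z.im)) atImInfty (𝓝 0) := by
  have h : Tendsto (fun z : ℍ => z.im) atImInfty atTop := tendsto_comap
  have : Tendsto (fun z : ℍ => -c * z.im) atImInfty atBot :=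
    h.const_mul_atTop_of_neg (by linarith)
  exact Real.tendsto_exp_atBot.comp this

lemma tendsto_theta : Tendsto (fun z : ℍ => theta z) atImInfty (𝓝 1) := by
  rw [tendsto_iff_norm_sub_tendsto_zero]
  have h := tendsto_exp_neg_mul_im (c := 2 * π) (by positivity)
  have h2 : Tendsto (fun z : ℍ => 2 / (1 - rexp (-(2 * π) * z.im)) * rexp (-(2 * π) * z.im))
      atImInfty (𝓝 (2 / (1 - 0) * 0)) :=
    ((tendsto_const_nhds (x := (2 : ℝ))).div (tendsto_const_nhds.sub h) (by norm_num)).mul h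
  rw [mul_zero] at h2
  refine squeeze_zero (fun _ => norm_nonneg _) (fun z => ?_) h2
  have := norm_jacobiTheta_sub_one_le (τ := 2 * (z : ℂ)) (by simpa using z.im_pos)
  rw [theta_eq_jacobiTheta]
  convert! this using 3 <;> simp <;> ring_nf

lemma tendsto_phi_div : Tendsto
    (fun z : ℍ => phi z / Complex.exp (π * Complex.I * z / 2)) atImInfty (𝓝 2) := by
  rw [tendsto_iff_norm_sub_tendsto_zero]
  have h := tendsto_exp_neg_mul_im (c := π / 2) (by positivity)
  have h2 : Tendsto (fun z : ℍ => 2 / (1 - rexp (-(π / 2) * z.im)) * rexp (-(π / 2) * z.im))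
      atImInfty (𝓝 (2 / (1 - 0) * 0)) :=
    ((tendsto_const_nhds (x := (2 : ℝ))).div (tendsto_const_nhds.sub h) (by norm_num)).mul h
  rw [mul_zero] at h2
  refine squeeze_zero (fun _ => norm_nonneg _) (fun z => ?_) h2
  have hE : ‖Complex.exp (π * Complex.I * z / 2)‖ = rexp (-(π / 2) * z.im) := by
    rw [Complex.norm_exp]
    congr 1
    simp [Complex.mul_re]
    ring
  have hne := Complex.exp_ne_zero (π * Complex.I * z / 2)
  have e : phi z / Complex.exp (π * Complex.I * z / 2) - 2 =
      (phi z - 2 * Complex.exp (π * Complex.I * z / 2)) / Complex.exp (π * Complex.I * z / 2) := by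
    field_simp
  rw [e, norm_div, hE, div_le_iff₀ (Real.exp_pos _)]
  refine (norm_phi_sub_le z.im_pos).trans (le_of_eq ?_)
  rw [show -π * ((z : ℂ).im / 2) = -(π / 2) * z.im by simp; ring]
  ring

lemma tendsto_phi : Tendsto (fun z : ℍ => phi z) atImInfty (𝓝 0) := by
  have hE : Tendsto (fun z : ℍ => Complex.exp (π * Complex.I * z / 2)) atImInfty (𝓝 0) := by
    rw [tendsto_zero_iff_norm_tendsto_zero]
    refine (tendsto_exp_neg_mul_im (c := π / 2) (by positivity)).congr fun z => ?_
    rw [Complex.norm_exp]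
    congr 1
    simp [Complex.mul_re]
    ring
  have := tendsto_phi_div.mul hE
  rw [mul_zero] at this
  exact this.congr fun z => div_mul_cancel₀ _ (Complex.exp_ne_zero _)

/-! ### Forms of level one -/

lemma mdifferentiable_of_differentiableAt {f : ℂ → ℂ}
    (hf : ∀ z : ℂ, 0 < z.im → DifferentiableAt ℂ f z) : MDiff (fun z : ℍ => f z) := by
  intro z
  exact (hf z z.im_pos).mdifferentiableAt.comp z z.mdifferentiable_coe

lemma slash_T_apply (f : ℂ → ℂ) (k : ℤ) (z : ℍ) :
    ((fun w : ℍ => f w) ∣[k] ModularGroup.T) z = f (z + 1) := by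
  rw [SL_slash_apply, modular_T_smul, ModularGroup.denom_apply]
  simp [ModularGroup.T, add_comm]

lemma slash_S_apply (f : ℂ → ℂ) (k : ℤ) (z : ℍ) :
    ((fun w : ℍ => f w) ∣[k] ModularGroup.S) z = f (-1 / z) * (z : ℂ) ^ (-k) := by
  rw [SL_slash_apply, modular_S_smul, ModularGroup.denom_S]
  congr 2
  simp [inv_neg, neg_div]

/-- A modular form of level one, from its behaviour under the generators `S` and `T`. -/
def levelOneForm (f : ℍ → ℂ) (k : ℤ) (hS : f ∣[k] ModularGroup.S = f)
    (hT : f ∣[k] ModularGroup.T = f) (hf : MDiff f) (hb : IsBoundedAtImInfty f) :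
    ModularForm 𝒮ℒ k where
  toFun := f
  slash_action_eq' A hA := by
    obtain ⟨A, rfl⟩ := hA
    exact SlashInvariantForm.slash_action_generators_SL2Z hS hT A
  holo' := hf
  bdd_at_cusps' hc := by
    rw [OnePoint.isBoundedAt_iff_forall_SL2Z hc]
    intro γ _
    rw [SlashInvariantForm.slash_action_generators_SL2Z hS hT]
    exact hb

/-- A cusp form of level one, from its behaviour under the generators `S` and `T`. -/
def levelOneCuspForm (f : ℍ → ℂ) (k : ℤ) (hS : f ∣[k] ModularGroup.S = f)
    (hT : f ∣[k] ModularGroup.T = f) (hf : MDiff f) (hb : IsZeroAtImInfty f) :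
    CuspForm 𝒮ℒ k where
  toFun := f
  slash_action_eq' A hA := by
    obtain ⟨A, rfl⟩ := hA
    exact SlashInvariantForm.slash_action_generators_SL2Z hS hT A
  holo' := hf
  zero_at_cusps' hc := by
    rw [OnePoint.isZeroAt_iff_forall_SL2Z hc]
    intro γ _
    rw [SlashInvariantForm.slash_action_generators_SL2Z hS hT]
    exact hb

/-! ### The theta functions have no zeros -/

/-- The cusp form `θ φ (θ ^ 4 - φ ^ 4)` of weight three. -/
noncomputable def thetaProd (z : ℂ) : ℂ := theta z * phi z * (theta z ^ 4 - phi z ^ 4)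

lemma thetaProd_add_one {z : ℂ} (hz : 0 < z.im) :
    thetaProd (z + 1) = Complex.I * thetaProd z := by
  rw [thetaProd, theta_add_one, phi_add_one hz, thetaProd, mul_pow, Complex.I_pow_four]
  ring

lemma thetaProd_neg_inv {z : ℂ} (hz : 0 < z.im) :
    thetaProd (-1 / z) = Complex.I * z ^ 3 * thetaProd z := by
  rw [thetaProd, theta_neg_inv hz, phi_neg_inv hz, thetaProd]
  have h : thetaFactor z ^ 6 = Complex.I * z ^ 3 / 8 := by
    rw [show thetaFactor z ^ 6 = (thetaFactor z ^ 2) ^ 3 by ring, thetaFactor_sq]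
    have := Complex.I_sq
    linear_combination (-z ^ 3 / 8 * Complex.I) * this
  linear_combination (8 * theta z * phi z * (theta z ^ 4 - phi z ^ 4)) * h

lemma tendsto_thetaProd_div : Tendsto
    (fun z : ℍ => thetaProd z / Complex.exp (π * Complex.I * z / 2)) atImInfty (𝓝 2) := by
  have h := (tendsto_theta.mul tendsto_phi_div).mul ((tendsto_theta.pow 4).sub (tendsto_phi.pow 4))
  norm_num at h
  exact h.congr fun z => by rw [thetaProd]; ring

/-- The fourth power of `thetaProd`, as a cusp form of level one. -/
noncomputable def thetaProdPowForm : CuspForm 𝒮ℒ 12 :=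
  levelOneCuspForm (fun z => thetaProd z ^ 4) 12
    (by
      ext z
      rw [slash_S_apply (fun z => thetaProd z ^ 4), thetaProd_neg_inv z.im_pos]
      have hz := z.ne_zero
      rw [mul_pow, mul_pow, Complex.I_pow_four]
      field_simp)
    (by
      ext z
      rw [slash_T_apply (fun z => thetaProd z ^ 4), thetaProd_add_one z.im_pos, mul_pow,
        Complex.I_pow_four, one_mul])
    (mdifferentiable_of_differentiableAt fun z hz => by
      have h1 := differentiableAt_theta hz
      have h2 := differentiableAt_phi hz
      exact (((h1.mul h2).mul ((h1.pow 4).sub (h2.pow 4))).pow 4))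
    (by
      have h := ((tendsto_theta.mul tendsto_phi).mul
        ((tendsto_theta.pow 4).sub (tendsto_phi.pow 4))).pow 4
      norm_num at h
      exact h)

/-- The cusp forms of weight 12 are the multiples of the discriminant, which has no zeros. The
multiple is nonzero because `thetaProd` is asymptotic to 2q^{1/4}. -/
lemma thetaProd_ne_zero (z : ℍ) : thetaProd z ≠ 0 := by
  obtain ⟨c, hc⟩ := CuspForm.exists_smul_discriminant_of_weight_eq_twelve thetaProdPowForm
  have hc' : ∀ z : ℍ, c * discriminant z = thetaProd z ^ 4 := fun z =>
    congrArg (fun f : CuspForm 𝒮ℒ 12 => f z) hc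
  obtain ⟨w, hw⟩ := (tendsto_thetaProd_div.eventually_ne two_ne_zero).exists
  have hc0 : c ≠ 0 := by
    rintro rfl
    have := hc' w
    rw [zero_mul] at this
    exact hw (by rw [pow_eq_zero_iff four_ne_zero |>.mp this.symm, zero_div])
  intro h
  have := hc' z
  rw [h] at this
  exact mul_ne_zero hc0 (discriminant_ne_zero z) (by simpa using this)

lemma theta_ne_zero (z : ℍ) : theta z ≠ 0 := fun h => thetaProd_ne_zero z (by simp [thetaProd, h])

/-! ### The Hauptmodul `φ / θ` -/

/-- The Hauptmodul `φ / θ` of `Γ(4)`. -/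
noncomputable def hauptmodul (z : ℂ) : ℂ := phi z / theta z

lemma hauptmodul_mul_theta (z : ℍ) : hauptmodul z * theta z = phi z :=
  div_mul_cancel₀ _ (theta_ne_zero z)

lemma thetaProd_eq (z : ℍ) :
    thetaProd z = theta z ^ 6 * (hauptmodul z * (1 - hauptmodul z ^ 4)) := by
  rw [thetaProd, ← hauptmodul_mul_theta]
  ring

lemma hauptmodul_mul_ne_zero (z : ℍ) : hauptmodul z * (1 - hauptmodul z ^ 4) ≠ 0 := by
  have := thetaProd_ne_zero z
  rw [thetaProd_eq] at this
  exact right_ne_zero_of_mul this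

lemma hauptmodul_ne_zero (z : ℍ) : hauptmodul z ≠ 0 :=
  left_ne_zero_of_mul (hauptmodul_mul_ne_zero z)

lemma one_add_hauptmodul_ne_zero (z : ℍ) : 1 + hauptmodul z ≠ 0 := fun h => by
  have := right_ne_zero_of_mul (hauptmodul_mul_ne_zero z)
  apply this
  rw [show hauptmodul z = -1 by linear_combination h]
  norm_num

lemma one_sub_hauptmodul_ne_zero (z : ℍ) : 1 - hauptmodul z ≠ 0 := fun h => by
  have := right_ne_zero_of_mul (hauptmodul_mul_ne_zero z)
  apply this
  rw [show hauptmodul z = 1 by linear_combination -h]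
  norm_num

lemma hauptmodul_add_one {z : ℂ} (hz : 0 < z.im) :
    hauptmodul (z + 1) = Complex.I * hauptmodul z := by
  rw [hauptmodul, theta_add_one, phi_add_one hz, hauptmodul, mul_div_assoc]

lemma thetaFactor_ne_zero {z : ℂ} (hz : 0 < z.im) : thetaFactor z ≠ 0 := fun h => by
  have := thetaFactor_mul_thetaFactor_neg_inv hz
  rw [h, zero_mul] at this
  norm_num at this

lemma hauptmodul_neg_inv {z : ℂ} (hz : 0 < z.im) :
    hauptmodul (-1 / z) = (1 - hauptmodul z) / (1 + hauptmodul z) := by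
  have h0 : theta z ≠ 0 := theta_ne_zero ⟨z, hz⟩
  have h1 : 1 + hauptmodul z ≠ 0 := one_add_hauptmodul_ne_zero ⟨z, hz⟩
  have hs := thetaFactor_ne_zero hz
  have hp : phi z = hauptmodul z * theta z := (hauptmodul_mul_theta ⟨z, hz⟩).symm
  conv_lhs => rw [hauptmodul, theta_neg_inv hz, phi_neg_inv hz, hp]
  rw [show theta z + hauptmodul z * theta z = theta z * (1 + hauptmodul z) by ring,
    show theta z - hauptmodul z * theta z = theta z * (1 - hauptmodul z) by ring]
  field_simp

lemma differentiableAt_hauptmodul {z : ℂ} (hz : 0 < z.im) : DifferentiableAt ℂ hauptmodul z :=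
  (differentiableAt_phi hz).div (differentiableAt_theta hz) (theta_ne_zero ⟨z, hz⟩)

lemma tendsto_hauptmodul_div : Tendsto
    (fun z : ℍ => hauptmodul z / Complex.exp (π * Complex.I * z / 2)) atImInfty (𝓝 2) := by
  have := tendsto_phi_div.div tendsto_theta one_ne_zero
  rw [div_one] at this
  exact this.congr fun z => by simp only [Pi.div_apply, hauptmodul]; ring

lemma tendsto_hauptmodul : Tendsto (fun z : ℍ => hauptmodul z) atImInfty (𝓝 0) := by
  have := tendsto_phi.div tendsto_theta one_ne_zero
  rw [zero_div] at this
  exact this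

lemma deriv_hauptmodul_add_one {z : ℂ} (hz : 0 < z.im) :
    deriv hauptmodul (z + 1) = Complex.I * deriv hauptmodul z := by
  rw [← deriv_comp_add_const, ← deriv_const_mul _ (differentiableAt_hauptmodul hz)]
  apply Filter.EventuallyEq.deriv_eq
  filter_upwards [isOpen_upperHalfPlaneSet.mem_nhds hz] with w hw
  exact hauptmodul_add_one hw

lemma deriv_hauptmodul_neg_inv {z : ℂ} (hz : 0 < z.im) :
    deriv hauptmodul (-1 / z) = -2 * z ^ 2 * deriv hauptmodul z / (1 + hauptmodul z) ^ 2 := by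
  have hz0 : z ≠ 0 := fun h => by simp [h] at hz
  have h1 : 1 + hauptmodul z ≠ 0 := one_add_hauptmodul_ne_zero ⟨z, hz⟩
  have hd := (differentiableAt_hauptmodul hz).hasDerivAt
  have hinv : HasDerivAt (fun w : ℂ => -1 / w) (1 / z ^ 2) z := by
    have := (hasDerivAt_inv hz0).const_mul (-1)
    convert! this using 1
    ring
  have hL := ((differentiableAt_hauptmodul (im_neg_inv_pos hz)).hasDerivAt).comp z hinv
  have hR := ((hasDerivAt_const z (1 : ℂ)).sub hd).div ((hasDerivAt_const z (1 : ℂ)).add hd) h1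
  have hE : (hauptmodul ∘ fun w : ℂ => -1 / w) =ᶠ[𝓝 z]
      (fun w => (1 - hauptmodul w) / (1 + hauptmodul w)) := by
    filter_upwards [isOpen_upperHalfPlaneSet.mem_nhds hz] with w hw
    exact hauptmodul_neg_inv hw
  have := hL.unique (hR.congr_of_eventuallyEq hE)
  simp only [Pi.add_apply, Pi.sub_apply] at this
  field_simp at this ⊢
  linear_combination this

/-- The quotient of the derivative of the Hauptmodul by `θ ^ 4 r (1 - r ^ 4)`, a constant. -/
noncomputable def logDerivQuot (z : ℂ) : ℂ :=
  deriv hauptmodul z / (theta z ^ 4 * (hauptmodul z * (1 - hauptmodul z ^ 4)))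

/-- The denominator is asymptotic to 2q^{1/4}. Cauchy's estimate on unit discs bounds r' by a
constant times |q^{1/4}|, since r itself has that bound. -/
lemma isBoundedAtImInfty_logDerivQuot : IsBoundedAtImInfty (fun z : ℍ => logDerivQuot z) := by
  have hnorm : ∀ z : ℂ, ‖Complex.exp (π * Complex.I * z / 2)‖ = rexp (-(π / 2) * z.im) := by
    intro z
    rw [Complex.norm_exp]
    congr 1
    simp [Complex.mul_re]
    ring
  have h3 : ∀ᶠ z : ℍ in atImInfty, ‖hauptmodul z‖ ≤ 3 * rexp (-(π / 2) * z.im) := by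
    have := tendsto_hauptmodul_div.norm.eventually (gt_mem_nhds
      (show ‖(2 : ℂ)‖ < 3 by rw [Complex.norm_two]; norm_num))
    filter_upwards [this] with z hz
    rw [norm_div, hnorm, div_lt_iff₀ (Real.exp_pos _)] at hz
    exact hz.le
  obtain ⟨A, hA⟩ := (atImInfty_mem _).mp h3
  have hder : (fun z : ℍ => deriv hauptmodul z / Complex.exp (π * Complex.I * z / 2))
      =O[atImInfty] (1 : ℍ → ℝ) := by
    refine Asymptotics.IsBigO.of_bound (3 * rexp (π / 2)) ?_
    -- The margin 2 keeps the closed unit disc about z inside ℍ and inside the region where `hA`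
    -- applies.
    refine (atImInfty_mem _).mpr ⟨max A 0 + 2, fun z hz => ?_⟩
    have hsub : ∀ w : ℂ, ‖w - z‖ ≤ 1 → max A 0 + 1 ≤ w.im ∧ z.im - 1 ≤ w.im := by
      intro w hw
      have h1 := (Complex.abs_im_le_norm (w - z)).trans hw
      rw [Complex.sub_im, abs_le] at h1
      have : (z : ℂ).im = z.im := rfl
      constructor <;> linarith [h1.1]
    have hd : ‖deriv hauptmodul z‖ ≤ 3 * rexp (-(π / 2) * (z.im - 1)) / 1 := by
      apply Complex.norm_deriv_le_of_forall_mem_sphere_norm_le one_pos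
      · apply DifferentiableOn.diffContOnCl
        rw [closure_ball _ one_ne_zero]
        intro w hw
        have := hsub w (by simpa [dist_eq_norm] using hw)
        exact (differentiableAt_hauptmodul
          (by linarith [this.1, le_max_right A 0])).differentiableWithinAt
      · intro w hw
        have := hsub w (by simpa [dist_eq_norm] using (mem_sphere_iff_norm.mp hw).le)
        have hw0 : 0 < w.im := by linarith [this.1, le_max_right A 0]
        refine (hA ⟨w, hw0⟩ (by
          change A ≤ w.im
          linarith [this.1, le_max_left A 0])).trans ?_
        gcongr ?_ * rexp ?_
        have h2 : (⟨w, hw0⟩ : ℍ).im = w.im := rfl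
        rw [h2]
        nlinarith [pi_pos, this.2]
    simp only [Set.mem_ofPred_eq, Pi.one_apply, norm_div, hnorm, norm_one, mul_one]
    rw [div_le_iff₀ (Real.exp_pos _), mul_assoc, ← Real.exp_add]
    rw [div_one] at hd
    convert! hd using 3
    have : (z : ℂ).im = z.im := rfl
    rw [this]
    ring
  have hden : Tendsto (fun z : ℍ => theta z ^ 4 *
      (hauptmodul z / Complex.exp (π * Complex.I * z / 2) * (1 - hauptmodul z ^ 4)))
      atImInfty (𝓝 2) := by
    have := (tendsto_theta.pow 4).mul
      (tendsto_hauptmodul_div.mul ((tendsto_hauptmodul.pow 4).const_sub 1))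
    norm_num at this
    exact this
  have hmul := hder.mul ((hden.inv₀ two_ne_zero).isBigO_one ℝ)
  rw [IsBoundedAtImInfty, BoundedAtFilter]
  refine (hmul.congr (fun z => ?_) (fun z => ?_))
  · have := Complex.exp_ne_zero (π * Complex.I * z / 2)
    have h1 := hauptmodul_ne_zero z
    have h2 := theta_ne_zero z
    have h3 := right_ne_zero_of_mul (hauptmodul_mul_ne_zero z)
    rw [logDerivQuot]
    field_simp
  · simp

lemma differentiableAt_logDerivQuot {z : ℂ} (hz : 0 < z.im) :
    DifferentiableAt ℂ logDerivQuot z := by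
  have hd : DifferentiableAt ℂ (deriv hauptmodul) z := by
    have : DifferentiableOn ℂ hauptmodul upperHalfPlaneSet := fun w hw =>
      (differentiableAt_hauptmodul hw).differentiableWithinAt
    exact (this.deriv isOpen_upperHalfPlaneSet).differentiableAt
      (isOpen_upperHalfPlaneSet.mem_nhds hz)
  have h := differentiableAt_hauptmodul hz
  refine hd.div (((differentiableAt_theta hz).pow 4).mul (h.mul ((h.pow 4).const_sub 1))) ?_
  exact mul_ne_zero (pow_ne_zero _ (theta_ne_zero ⟨z, hz⟩)) (hauptmodul_mul_ne_zero ⟨z, hz⟩)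

/-- Under z ↦ -1/z the powers of z and of 1 + r coming from r', θ⁴ and r(1 - r⁴) cancel. What
remains is a level one form of weight 0, hence constant. -/
lemma exists_logDerivQuot_eq : ∃ c : ℂ, ∀ z : ℍ, logDerivQuot z = c := by
  have hS : (fun z : ℍ => logDerivQuot z) ∣[(0 : ℤ)] ModularGroup.S =
      fun z : ℍ => logDerivQuot z := by
    ext z
    rw [slash_S_apply logDerivQuot]
    have hz := z.ne_zero
    have h1 := one_add_hauptmodul_ne_zero z
    have h2 := hauptmodul_ne_zero z
    have h3 := right_ne_zero_of_mul (hauptmodul_mul_ne_zero z)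
    have h4 := theta_ne_zero z
    have h5 : theta z + phi z = theta z * (1 + hauptmodul z) := by
      rw [← hauptmodul_mul_theta]; ring
    have h6 : thetaFactor z ^ 4 = -(z : ℂ) ^ 2 / 4 := by
      rw [show thetaFactor z ^ 4 = (thetaFactor z ^ 2) ^ 2 by ring, thetaFactor_sq]
      have := Complex.I_sq
      linear_combination (z ^ 2 / 4 : ℂ) * this
    rw [logDerivQuot, logDerivQuot, deriv_hauptmodul_neg_inv z.im_pos, theta_neg_inv z.im_pos,
      hauptmodul_neg_inv z.im_pos, h5, mul_pow, mul_pow, h6]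
    generalize hauptmodul z = r at *
    -- The sextic form θφ(θ⁴ - φ⁴) is invariant up to a constant under (θ, φ) ↦ (θ + φ, θ - φ); this
    -- is its dehomogenized form.
    have h7 : (1 - r) / (1 + r) * (1 - ((1 - r) / (1 + r)) ^ 4) =
        8 * (r * (1 - r ^ 4)) / (1 + r) ^ 6 := by
      field_simp
      ring
    rw [h7]
    simp only [neg_zero, zpow_zero, mul_one]
    field_simp
    ring
  have hT : (fun z : ℍ => logDerivQuot z) ∣[(0 : ℤ)] ModularGroup.T =
      fun z : ℍ => logDerivQuot z := by
    ext z
    rw [slash_T_apply logDerivQuot, logDerivQuot, logDerivQuot,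
      deriv_hauptmodul_add_one z.im_pos, hauptmodul_add_one z.im_pos, theta_add_one, mul_pow,
      Complex.I_pow_four, one_mul, mul_assoc Complex.I, mul_left_comm _ Complex.I,
      mul_div_mul_left _ _ Complex.I_ne_zero]
  obtain ⟨c, hc⟩ := ModularFormClass.levelOne_weight_zero_const
    (levelOneForm _ 0 hS hT (mdifferentiable_of_differentiableAt fun z hz =>
      differentiableAt_logDerivQuot hz) isBoundedAtImInfty_logDerivQuot)
  exact ⟨c, fun z => congrFun hc z⟩

/-- One zero of r' would make the constant 0, hence r constant and equal to its limit 0 at infinity,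
a value that r omits. -/
lemma deriv_hauptmodul_ne_zero (z : ℍ) : deriv hauptmodul z ≠ 0 := by
  obtain ⟨c, hc⟩ := exists_logDerivQuot_eq
  intro h0
  have hc0 : c = 0 := by
    rw [← hc z, logDerivQuot, h0, zero_div]
  have hall : ∀ w : ℂ, 0 < w.im → deriv hauptmodul w = 0 := by
    intro w hw
    have := hc ⟨w, hw⟩
    rw [hc0, logDerivQuot, div_eq_zero_iff] at this
    refine this.resolve_right ?_
    exact mul_ne_zero (pow_ne_zero _ (theta_ne_zero ⟨w, hw⟩)) (hauptmodul_mul_ne_zero ⟨w, hw⟩)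
  have hconst : ∀ w : ℍ, hauptmodul w = hauptmodul z := by
    intro w
    have hconv : Convex ℝ upperHalfPlaneSet := convex_halfSpace_im_gt 0
    refine isOpen_upperHalfPlaneSet.is_const_of_deriv_eq_zero hconv.isPreconnected
      (fun w hw => (differentiableAt_hauptmodul hw).differentiableWithinAt) hall w.im_pos z.im_pos
  have h1 : Tendsto (fun _ : ℍ => hauptmodul z) atImInfty (𝓝 0) :=
    tendsto_hauptmodul.congr hconst
  exact hauptmodul_ne_zero z (tendsto_nhds_unique tendsto_const_nhds h1)

end WeightOne

namespace WeightOne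

open Filter Real ModularGroup

/-! ### The action of `SL(2, ℤ)` on the squares of the theta constants -/

/-- The functions `2 θ φ`, `θ ^ 2 + φ ^ 2`, `θ ^ 2 - φ ^ 2`, that is, the squares of the classical
theta constants. -/
noncomputable def thetaSq : Fin 3 → ℂ → ℂ :=
  ![fun z => 2 * theta z * phi z, fun z => theta z ^ 2 + phi z ^ 2,
    fun z => theta z ^ 2 - phi z ^ 2]

/-- `thetaSq`, restricted to the upper half plane. -/
noncomputable def thetaSqFun (j : Fin 3) (z : ℍ) : ℂ := thetaSq j z

lemma thetaSqFun_zero_slash_T : thetaSqFun 0 ∣[(1 : ℤ)] T = Complex.I • thetaSqFun 0 := by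
  ext z
  refine (slash_T_apply (thetaSq 0) 1 z).trans ?_
  simp only [thetaSq, thetaSqFun, Matrix.cons_val_zero, Pi.smul_apply, smul_eq_mul]
  rw [theta_add_one, phi_add_one z.im_pos]
  ring

lemma thetaSqFun_one_slash_T : thetaSqFun 1 ∣[(1 : ℤ)] T = thetaSqFun 2 := by
  ext z
  refine (slash_T_apply (thetaSq 1) 1 z).trans ?_
  simp only [thetaSq, thetaSqFun, Matrix.cons_val]
  rw [theta_add_one, phi_add_one z.im_pos, mul_pow, Complex.I_sq]
  ring

lemma thetaSqFun_two_slash_T : thetaSqFun 2 ∣[(1 : ℤ)] T = thetaSqFun 1 := by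
  ext z
  refine (slash_T_apply (thetaSq 2) 1 z).trans ?_
  simp only [thetaSq, thetaSqFun, Matrix.cons_val]
  rw [theta_add_one, phi_add_one z.im_pos, mul_pow, Complex.I_sq]
  ring

lemma thetaSqFun_zero_slash_S : thetaSqFun 0 ∣[(1 : ℤ)] S = (-Complex.I) • thetaSqFun 2 := by
  ext z
  refine (slash_S_apply (thetaSq 0) 1 z).trans ?_
  simp only [thetaSq, thetaSqFun, Matrix.cons_val, Pi.smul_apply, smul_eq_mul]
  rw [theta_neg_inv z.im_pos, phi_neg_inv z.im_pos, zpow_neg_one, ← div_eq_mul_inv,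
    div_eq_iff z.ne_zero]
  linear_combination 2 * (theta z ^ 2 - phi z ^ 2) * thetaFactor_sq z

lemma thetaSqFun_one_slash_S : thetaSqFun 1 ∣[(1 : ℤ)] S = (-Complex.I) • thetaSqFun 1 := by
  ext z
  refine (slash_S_apply (thetaSq 1) 1 z).trans ?_
  simp only [thetaSq, thetaSqFun, Matrix.cons_val, Pi.smul_apply, smul_eq_mul]
  rw [theta_neg_inv z.im_pos, phi_neg_inv z.im_pos, zpow_neg_one, ← div_eq_mul_inv,
    div_eq_iff z.ne_zero]
  linear_combination 2 * (theta z ^ 2 + phi z ^ 2) * thetaFactor_sq z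

lemma thetaSqFun_two_slash_S : thetaSqFun 2 ∣[(1 : ℤ)] S = (-Complex.I) • thetaSqFun 0 := by
  ext z
  refine (slash_S_apply (thetaSq 2) 1 z).trans ?_
  simp only [thetaSq, thetaSqFun, Matrix.cons_val, Pi.smul_apply, smul_eq_mul]
  rw [theta_neg_inv z.im_pos, phi_neg_inv z.im_pos, zpow_neg_one, ← div_eq_mul_inv,
    div_eq_iff z.ne_zero]
  linear_combination 4 * (theta z * phi z) * thetaFactor_sq z

lemma slash_inv_of_slash {f g : ℍ → ℂ} {γ : SL(2, ℤ)} {c : ℂ} (hc : c ≠ 0)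
    (h : f ∣[(1 : ℤ)] γ = c • g) : g ∣[(1 : ℤ)] γ⁻¹ = c⁻¹ • f := by
  have : (f ∣[(1 : ℤ)] γ) ∣[(1 : ℤ)] γ⁻¹ = f := by
    rw [← SlashAction.slash_mul, mul_inv_cancel, SlashAction.slash_one]
  rw [← this, h, SL_smul_slash, inv_smul_smul₀ hc]

/-- The group `SL(2, ℤ)` permutes the squares of the theta constants, up to constants. -/
lemma exists_perm_thetaSqFun_slash (γ : SL(2, ℤ)) : ∃ (σ : Equiv.Perm (Fin 3)) (c : Fin 3 → ℂ),
    (∀ j, c j ≠ 0) ∧ ∀ j, thetaSqFun j ∣[(1 : ℤ)] γ = c j • thetaSqFun (σ j) := by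
  have hγ : γ ∈ Subgroup.closure {S, T} := by
    simp [_root_.SpecialLinearGroup.SL2Z_generators]
  induction hγ using Subgroup.closure_induction with
  | mem x hx =>
    rcases hx with rfl | rfl
    · refine ⟨Equiv.swap 0 2, fun _ => -Complex.I, by simp, fun j => ?_⟩
      fin_cases j
      · simpa using thetaSqFun_zero_slash_S
      · exact (by decide : Equiv.swap (0 : Fin 3) 2 1 = 1).symm ▸ thetaSqFun_one_slash_S
      · simpa using thetaSqFun_two_slash_S
    · refine ⟨Equiv.swap 1 2, ![Complex.I, 1, 1], fun j => ?_, fun j => ?_⟩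
      · fin_cases j <;> simp
      · fin_cases j
        · exact (by decide : Equiv.swap (1 : Fin 3) 2 0 = 0).symm ▸ thetaSqFun_zero_slash_T
        · simpa using thetaSqFun_one_slash_T
        · simpa using thetaSqFun_two_slash_T
  | one => exact ⟨1, fun _ => 1, by simp, by simp⟩
  | mul x y _ _ hx hy =>
    obtain ⟨σ, c, hc, hσ⟩ := hx
    obtain ⟨τ, d, hd, hτ⟩ := hy
    refine ⟨τ * σ, fun j => c j * d (σ j), fun j => mul_ne_zero (hc j) (hd _), fun j => ?_⟩
    rw [SlashAction.slash_mul, hσ, SL_smul_slash, hτ, smul_smul]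
    rfl
  | inv x _ hx =>
    obtain ⟨σ, c, hc, hσ⟩ := hx
    refine ⟨σ⁻¹, fun j => (c (σ⁻¹ j))⁻¹, fun j => inv_ne_zero (hc _), fun j => ?_⟩
    apply slash_inv_of_slash (hc _)
    rw [hσ]
    simp

/-! ### The action of Γ(2) on the squares of the theta constants by signs. -/

lemma neg_one_zpow_congr {m n : ℤ} (h : Even (m - n)) : (-1 : ℂ) ^ m = (-1 : ℂ) ^ n := by
  rw [← sub_add_cancel m n, zpow_add₀ (by norm_num), h.neg_one_zpow, one_mul]

/-- An element of `Γ(2)` acts on the squares of the theta constants by the signs that are given by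
its entries modulo `4`. -/
def ActsBySigns (γ : SL(2, ℤ)) : Prop :=
  ∃ a b c d : ℤ, γ 0 0 = 1 + 2 * a ∧ γ 0 1 = 2 * b ∧ γ 1 0 = 2 * c ∧ γ 1 1 = 1 + 2 * d ∧
    thetaSqFun 0 ∣[(1 : ℤ)] γ = (-1 : ℂ) ^ (a + b) • thetaSqFun 0 ∧
    thetaSqFun 1 ∣[(1 : ℤ)] γ = (-1 : ℂ) ^ a • thetaSqFun 1 ∧
    thetaSqFun 2 ∣[(1 : ℤ)] γ = (-1 : ℂ) ^ (a + c) • thetaSqFun 2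

lemma slash_T_sq_of (f g h : ℍ → ℂ) (u v : ℂ) (hf : f ∣[(1 : ℤ)] T = u • g)
    (hg : g ∣[(1 : ℤ)] T = v • h) : f ∣[(1 : ℤ)] (T ^ 2) = (u * v) • h := by
  rw [pow_two, SlashAction.slash_mul, hf, SL_smul_slash, hg, smul_smul]

lemma coe_T_sq : ((T ^ 2 : SL(2, ℤ)) : Matrix (Fin 2) (Fin 2) ℤ) = !![1, 2; 0, 1] :=
  coe_T_zpow 2

lemma actsBySigns_T_sq : ActsBySigns (T ^ 2) := by
  refine ⟨0, 1, 0, 0, ?_, ?_, ?_, ?_, ?_, ?_, ?_⟩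
  · simp [pow_two]
  · simp [pow_two]
  · simp [pow_two]
  · simp [pow_two]
  · rw [slash_T_sq_of _ _ _ _ _ thetaSqFun_zero_slash_T thetaSqFun_zero_slash_T]
    simp
  · rw [slash_T_sq_of _ _ _ 1 1 (by simpa using thetaSqFun_one_slash_T)
      (by simpa using thetaSqFun_two_slash_T)]
    simp
  · rw [slash_T_sq_of _ _ _ 1 1 (by simpa using thetaSqFun_two_slash_T)
      (by simpa using thetaSqFun_one_slash_T)]
    simp

/-- The parabolic element `(1, 0; -2, 1)` of `Γ(2)`. -/
def lowerTwo : SL(2, ℤ) := S * T ^ 2 * S⁻¹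

lemma coe_lowerTwo : (lowerTwo : Matrix (Fin 2) (Fin 2) ℤ) = !![1, 0; -2, 1] := by
  rw [lowerTwo, Matrix.SpecialLinearGroup.coe_mul, Matrix.SpecialLinearGroup.coe_mul, coe_T_sq,
    Matrix.SpecialLinearGroup.coe_inv, coe_S]
  simp [Matrix.adjugate_fin_two]

lemma slash_lowerTwo_of (f g h k : ℍ → ℂ) (u v w : ℂ) (hw : w ≠ 0) (hf : f ∣[(1 : ℤ)] S = u • g)
    (hg : g ∣[(1 : ℤ)] (T ^ 2) = v • h) (hk : k ∣[(1 : ℤ)] S = w • h) :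
    f ∣[(1 : ℤ)] lowerTwo = (u * v * w⁻¹) • k := by
  rw [lowerTwo, SlashAction.slash_mul, SlashAction.slash_mul, hf, SL_smul_slash, hg,
    SL_smul_slash, SL_smul_slash, slash_inv_of_slash hw hk, smul_smul, smul_smul, mul_assoc]

lemma actsBySigns_lowerTwo : ActsBySigns lowerTwo := by
  obtain ⟨a, b, c, d, ha, hb, hc, hd, h0, h1, h2⟩ := actsBySigns_T_sq
  have ha' : a = 0 := by simp [pow_two] at ha; omega
  have hb' : b = 1 := by simp [pow_two] at hb; omega
  have hc' : c = 0 := by simp [pow_two] at hc; omega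
  subst ha' hb' hc'
  refine ⟨0, 0, -1, 0, ?_, ?_, ?_, ?_, ?_, ?_, ?_⟩
  · simp [coe_lowerTwo]
  · simp [coe_lowerTwo]
  · simp [coe_lowerTwo]
  · simp [coe_lowerTwo]
  · rw [slash_lowerTwo_of _ _ _ _ _ _ _ (by simp) thetaSqFun_zero_slash_S h2
      thetaSqFun_zero_slash_S]
    simp
  · rw [slash_lowerTwo_of _ _ _ _ _ _ _ (by simp) thetaSqFun_one_slash_S h1
      thetaSqFun_one_slash_S]
    simp
  · rw [slash_lowerTwo_of _ _ _ _ _ _ _ (by simp) thetaSqFun_two_slash_S h0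
      thetaSqFun_two_slash_S]
    simp

lemma slash_neg_one (f : ℍ → ℂ) : f ∣[(1 : ℤ)] (-1 : SL(2, ℤ)) = (-1 : ℂ) • f := by
  ext z
  rw [SL_slash_apply, denom_apply]
  simp

lemma actsBySigns_neg_one : ActsBySigns (-1) := by
  refine ⟨-1, 0, 0, -1, ?_, ?_, ?_, ?_, ?_, ?_, ?_⟩ <;> simp [slash_neg_one]

/-- Modulo 2 the matrix (γ - 1)/2 is additive in γ on Γ(2), so the signs are characters. -/
lemma ActsBySigns.mul {γ δ : SL(2, ℤ)} (hγ : ActsBySigns γ) (hδ : ActsBySigns δ) :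
    ActsBySigns (γ * δ) := by
  obtain ⟨a, b, c, d, ha, hb, hc, hd, h0, h1, h2⟩ := hγ
  obtain ⟨a', b', c', d', ha', hb', hc', hd', h0', h1', h2'⟩ := hδ
  refine ⟨a + a' + 2 * (a * a' + b * c'), b + b' + 2 * (a * b' + b * d'),
    c + c' + 2 * (c * a' + d * c'), d + d' + 2 * (d * d' + c * b'), ?_, ?_, ?_, ?_, ?_, ?_, ?_⟩
  · simp only [Matrix.SpecialLinearGroup.coe_mul, Matrix.mul_apply, Fin.sum_univ_two,
      ha, hb, ha', hc']
    ring
  · simp only [Matrix.SpecialLinearGroup.coe_mul, Matrix.mul_apply, Fin.sum_univ_two,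
      ha, hb, hb', hd']
    ring
  · simp only [Matrix.SpecialLinearGroup.coe_mul, Matrix.mul_apply, Fin.sum_univ_two,
      hc, hd, ha', hc']
    ring
  · simp only [Matrix.SpecialLinearGroup.coe_mul, Matrix.mul_apply, Fin.sum_univ_two,
      hc, hd, hb', hd']
    ring
  all_goals rw [SlashAction.slash_mul]
  · rw [h0, SL_smul_slash, h0', smul_smul, ← zpow_add₀ (by norm_num)]
    congr 1
    refine neg_one_zpow_congr ⟨-(a * a' + b * c') - (a * b' + b * d'), by ring⟩
  · rw [h1, SL_smul_slash, h1', smul_smul, ← zpow_add₀ (by norm_num)]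
    congr 1
    refine neg_one_zpow_congr ⟨-(a * a' + b * c'), by ring⟩
  · rw [h2, SL_smul_slash, h2', smul_smul, ← zpow_add₀ (by norm_num)]
    congr 1
    refine neg_one_zpow_congr ⟨-(a * a' + b * c') - (c * a' + d * c'), by ring⟩

lemma ActsBySigns.inv {γ : SL(2, ℤ)} (hγ : ActsBySigns γ) : ActsBySigns γ⁻¹ := by
  obtain ⟨a, b, c, d, ha, hb, hc, hd, h0, h1, h2⟩ := hγ
  have hdet := γ.det_coe
  rw [Matrix.det_fin_two, ha, hb, hc, hd] at hdet
  -- Hence a and d have the same parity, and the inverse, where they are exchanged, has the same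
  -- signs.
  have hdet' : a + d = 2 * (b * c - a * d) := by linarith
  have hne : ∀ n : ℤ, (-1 : ℂ) ^ n ≠ 0 := fun n => zpow_ne_zero _ (by norm_num)
  refine ⟨d, -b, -c, a, ?_, ?_, ?_, ?_, ?_, ?_, ?_⟩
  · simp [Matrix.SpecialLinearGroup.SL2_inv_expl, hd]
  · simp [Matrix.SpecialLinearGroup.SL2_inv_expl, hb]
  · simp [Matrix.SpecialLinearGroup.SL2_inv_expl, hc]
  · simp [Matrix.SpecialLinearGroup.SL2_inv_expl, ha]
  · rw [slash_inv_of_slash (hne _) h0, ← zpow_neg]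
    congr 1
    exact neg_one_zpow_congr ⟨-(b * c - a * d), by linarith⟩
  · rw [slash_inv_of_slash (hne _) h1, ← zpow_neg]
    congr 1
    exact neg_one_zpow_congr ⟨-(b * c - a * d), by linarith⟩
  · rw [slash_inv_of_slash (hne _) h2, ← zpow_neg]
    congr 1
    exact neg_one_zpow_congr ⟨-(b * c - a * d), by linarith⟩

/-- The group `Γ(2)` is generated by `(1, 2; 0, 1)`, `(1, 0; -2, 1)` and `-1`. -/
lemma mem_closure_of_even (γ : SL(2, ℤ)) (hb : Even (γ 0 1)) (hc : Even (γ 1 0)) :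
    γ ∈ Subgroup.closure {T ^ 2, lowerTwo, -1} := by
  have hT : T ^ 2 ∈ Subgroup.closure {T ^ 2, lowerTwo, -1} := Subgroup.subset_closure (by simp)
  have hL : lowerTwo ∈ Subgroup.closure {T ^ 2, lowerTwo, -1} := Subgroup.subset_closure (by simp)
  have hN : -1 ∈ Subgroup.closure {T ^ 2, lowerTwo, -1} := Subgroup.subset_closure (by simp)
  -- Euclid's algorithm on the first column (a, c), changing the larger entry by twice the smaller.
  -- As a is odd and c even, |a| ≠ |c|, so the sum drops strictly until c = 0.
  induction hn : (γ 0 0).natAbs + (γ 1 0).natAbs using Nat.strong_induction_on generalizing γ with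
  | _ n ih =>
    have hdet := γ.det_coe
    rw [Matrix.det_fin_two] at hdet
    have hstep : ∀ g ∈ Subgroup.closure {T ^ 2, lowerTwo, -1}, Even ((g * γ) 0 1) →
        Even ((g * γ) 1 0) → ((g * γ) 0 0).natAbs + ((g * γ) 1 0).natAbs < n →
        γ ∈ Subgroup.closure {T ^ 2, lowerTwo, -1} := fun g hg h1 h2 h3 =>
      (Subgroup.mul_mem_cancel_left _ hg).mp (ih _ h3 _ h1 h2 rfl)
    have hTm : ∀ i j, ((T ^ 2 * γ : SL(2, ℤ))) i j =
        !![γ 0 0 + 2 * γ 1 0, γ 0 1 + 2 * γ 1 1; γ 1 0, γ 1 1] i j := by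
      intro i j
      fin_cases i <;> fin_cases j <;>
        simp [pow_two, Matrix.mul_apply, Fin.sum_univ_two]
    have hTi : ∀ i j, (((T ^ 2)⁻¹ * γ : SL(2, ℤ))) i j =
        !![γ 0 0 - 2 * γ 1 0, γ 0 1 - 2 * γ 1 1; γ 1 0, γ 1 1] i j := by
      intro i j
      fin_cases i <;> fin_cases j <;>
        simp [pow_two, Matrix.mul_apply, Fin.sum_univ_two,
          Matrix.adjugate_fin_two, sub_eq_add_neg]
    have hLm : ∀ i j, ((lowerTwo * γ : SL(2, ℤ))) i j =
        !![γ 0 0, γ 0 1; γ 1 0 - 2 * γ 0 0, γ 1 1 - 2 * γ 0 1] i j := by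
      intro i j
      fin_cases i <;> fin_cases j <;>
        simp [coe_lowerTwo, Matrix.mul_apply, Fin.sum_univ_two] <;> ring
    have hLi : ∀ i j, ((lowerTwo⁻¹ * γ : SL(2, ℤ))) i j =
        !![γ 0 0, γ 0 1; γ 1 0 + 2 * γ 0 0, γ 1 1 + 2 * γ 0 1] i j := by
      intro i j
      fin_cases i <;> fin_cases j <;>
        simp [coe_lowerTwo, Matrix.mul_apply, Fin.sum_univ_two,
          Matrix.adjugate_fin_two] <;> ring
    have hao : Odd (γ 0 0) := by
      by_contra h
      rw [Int.not_odd_iff_even] at h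
      have h1 : Even (γ 0 0 * γ 1 1 - γ 0 1 * γ 1 0) := (h.mul_right _).sub (hb.mul_right _)
      rw [hdet] at h1
      exact absurd h1 (by decide)
    by_cases hc0 : γ 1 0 = 0
    · rw [hc0, mul_zero, sub_zero] at hdet
      obtain ⟨k, hk⟩ := hb
      rcases Int.mul_eq_one_iff_eq_one_or_neg_one.mp hdet with ⟨h1, h2⟩ | ⟨h1, h2⟩
      · have : γ = (T ^ 2) ^ k := by
          rw [← zpow_natCast, ← zpow_mul]
          ext i j
          rw [coe_T_zpow]
          fin_cases i <;> fin_cases j <;> simp [h1, h2, hc0, hk]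
          ring
        rw [this]
        exact zpow_mem hT k
      · have : γ = -1 * (T ^ 2) ^ (-k) := by
          rw [← zpow_natCast, ← zpow_mul, neg_one_mul]
          ext i j
          rw [Matrix.SpecialLinearGroup.coe_neg, coe_T_zpow]
          fin_cases i <;> fin_cases j <;> simp [h1, h2, hc0, hk]
          ring
        rw [this]
        exact mul_mem hN (zpow_mem hT _)
    · obtain ⟨x, hx⟩ := hao
      obtain ⟨y, hy⟩ := hc
      obtain ⟨k, hk⟩ := hb
      rcases le_or_gt ((γ 0 0).natAbs) ((γ 1 0).natAbs) with hlt | hlt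
      · rcases le_or_gt 0 (γ 0 0 * γ 1 0) with hs | hs
        · refine hstep _ hL ?_ ?_ ?_
          · rw [hLm]; exact ⟨k, by simpa using hk⟩
          · rw [hLm]; exact ⟨y - γ 0 0, by simp; omega⟩
          · rw [hLm, hLm]
            simp only [Matrix.of_apply, Matrix.cons_val', Matrix.cons_val_zero, Matrix.cons_val_one,
              Matrix.cons_val_fin_one]
            rcases mul_nonneg_iff.mp hs with ⟨h1, h2⟩ | ⟨h1, h2⟩ <;> omega
        · refine hstep _ (inv_mem hL) ?_ ?_ ?_
          · rw [hLi]; exact ⟨k, by simpa using hk⟩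
          · rw [hLi]; exact ⟨y + γ 0 0, by simp; omega⟩
          · rw [hLi, hLi]
            simp only [Matrix.of_apply, Matrix.cons_val', Matrix.cons_val_zero, Matrix.cons_val_one,
              Matrix.cons_val_fin_one]
            rcases mul_neg_iff.mp hs with ⟨h1, h2⟩ | ⟨h1, h2⟩ <;> omega
      · rcases le_or_gt 0 (γ 0 0 * γ 1 0) with hs | hs
        · refine hstep _ (inv_mem hT) ?_ ?_ ?_
          · rw [hTi]; exact ⟨k - γ 1 1, by simp; omega⟩
          · rw [hTi]; exact ⟨y, by simpa using hy⟩
          · rw [hTi, hTi]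
            simp only [Matrix.of_apply, Matrix.cons_val', Matrix.cons_val_zero, Matrix.cons_val_one,
              Matrix.cons_val_fin_one]
            rcases mul_nonneg_iff.mp hs with ⟨h1, h2⟩ | ⟨h1, h2⟩ <;> omega
        · refine hstep _ hT ?_ ?_ ?_
          · rw [hTm]; exact ⟨k + γ 1 1, by simp; omega⟩
          · rw [hTm]; exact ⟨y, by simpa using hy⟩
          · rw [hTm, hTm]
            simp only [Matrix.of_apply, Matrix.cons_val', Matrix.cons_val_zero, Matrix.cons_val_one,
              Matrix.cons_val_fin_one]
            rcases mul_neg_iff.mp hs with ⟨h1, h2⟩ | ⟨h1, h2⟩ <;> omega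

lemma actsBySigns_of_even (γ : SL(2, ℤ)) (hb : Even (γ 0 1)) (hc : Even (γ 1 0)) :
    ActsBySigns γ := by
  have h := mem_closure_of_even γ hb hc
  clear hb hc
  induction h using Subgroup.closure_induction with
  | mem x hx =>
    rcases hx with rfl | rfl | rfl
    exacts [actsBySigns_T_sq, actsBySigns_lowerTwo, actsBySigns_neg_one]
  | one => exact ⟨0, 0, 0, 0, by simp, by simp, by simp, by simp, by simp, by simp, by simp⟩
  | mul x y _ _ hx hy => exact hx.mul hy
  | inv x _ hx => exact hx.inv

lemma Gamma_four_iff {γ : SL(2, ℤ)} : γ ∈ Γ(4) ↔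
    (4 : ℤ) ∣ γ 0 0 - 1 ∧ (4 : ℤ) ∣ γ 0 1 ∧ (4 : ℤ) ∣ γ 1 0 ∧ (4 : ℤ) ∣ γ 1 1 - 1 := by
  have h : ∀ a : ℤ, (a : ZMod 4) = 1 ↔ (4 : ℤ) ∣ a - 1 := fun a => by
    have := ZMod.intCast_zmod_eq_zero_iff_dvd (a - 1) 4
    push_cast at this
    rw [← this, sub_eq_zero]
  have h' : ∀ a : ℤ, (a : ZMod 4) = 0 ↔ (4 : ℤ) ∣ a := fun a =>
    ZMod.intCast_zmod_eq_zero_iff_dvd a 4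
  rw [Gamma_mem, h, h', h', h]

lemma thetaSqFun_slash_of_mem {γ : SL(2, ℤ)} (hγ : γ ∈ Γ(4)) (j : Fin 3) :
    thetaSqFun j ∣[(1 : ℤ)] γ = thetaSqFun j := by
  obtain ⟨ha, hb, hc, hd⟩ := Gamma_four_iff.mp hγ
  have h2 : (2 : ℤ) ∣ 4 := by norm_num
  obtain ⟨a, b, c, d, ha', hb', hc', hd', h0, h1, h2⟩ := actsBySigns_of_even γ
    (even_iff_two_dvd.mpr (h2.trans hb)) (even_iff_two_dvd.mpr (h2.trans hc))
  have hea : Even a := by rw [even_iff_two_dvd]; omega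
  have heb : Even b := by rw [even_iff_two_dvd]; omega
  have hec : Even c := by rw [even_iff_two_dvd]; omega
  rw [(hea.add heb).neg_one_zpow, one_smul] at h0
  rw [hea.neg_one_zpow, one_smul] at h1
  rw [(hea.add hec).neg_one_zpow, one_smul] at h2
  fin_cases j
  exacts [h0, h1, h2]

end WeightOne

namespace WeightOne

open Filter ModularGroup

/-! ### The forms `M`, `N`, `P` are modular on `Γ(4)` -/

/-- The forms `M`, `N`, `P`, restricted to the upper half plane. -/
noncomputable def baseFun (i : Fin 3) (z : ℍ) : ℂ := baseForm i z

lemma baseFun_eq (i : Fin 3) : baseFun i = ![(1 / 2 : ℂ) • (thetaSqFun 1 + thetaSqFun 2),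
    thetaSqFun 0, (1 / 2 : ℂ) • (thetaSqFun 1 + (-1 : ℂ) • thetaSqFun 2)] i := by
  ext z
  fin_cases i <;> simp [baseFun, baseForm, thetaSqFun, thetaSq] <;> ring

lemma baseFun_slash_of_mem {γ : SL(2, ℤ)} (hγ : γ ∈ Γ(4)) (i : Fin 3) :
    baseFun i ∣[(1 : ℤ)] γ = baseFun i := by
  have h := thetaSqFun_slash_of_mem hγ
  rw [baseFun_eq]
  fin_cases i <;> simp [SL_smul_slash, SlashAction.add_slash, SlashAction.neg_slash, h]

lemma isBoundedAtImInfty_thetaSqFun (j : Fin 3) : IsBoundedAtImInfty (thetaSqFun j) := by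
  have h : ∃ c : ℂ, Tendsto (thetaSqFun j) atImInfty (𝓝 c) := by
    fin_cases j
    · exact ⟨_, (tendsto_theta.const_mul 2).mul tendsto_phi⟩
    · exact ⟨_, (tendsto_theta.pow 2).add (tendsto_phi.pow 2)⟩
    · exact ⟨_, (tendsto_theta.pow 2).sub (tendsto_phi.pow 2)⟩
  obtain ⟨c, hc⟩ := h
  exact hc.isBigO_one ℝ

/-- All cusps reduce to infinity, because slashing only permutes the three functions up to
constants. -/
lemma isBoundedAtImInfty_thetaSqFun_slash (j : Fin 3) (γ : SL(2, ℤ)) :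
    IsBoundedAtImInfty (thetaSqFun j ∣[(1 : ℤ)] γ) := by
  obtain ⟨σ, c, -, h⟩ := exists_perm_thetaSqFun_slash γ
  rw [h]
  exact (isBoundedAtImInfty_thetaSqFun (σ j)).const_mul_left (c j)

lemma isBoundedAtImInfty_baseFun_slash (i : Fin 3) (γ : SL(2, ℤ)) :
    IsBoundedAtImInfty (baseFun i ∣[(1 : ℤ)] γ) := by
  have h0 := isBoundedAtImInfty_thetaSqFun_slash 0 γ
  have h1 := isBoundedAtImInfty_thetaSqFun_slash 1 γ
  have h2 := isBoundedAtImInfty_thetaSqFun_slash 2 γ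
  rw [show baseFun i ∣[(1 : ℤ)] γ = _ from
    congrArg (fun f : ℍ → ℂ => f ∣[(1 : ℤ)] γ) (baseFun_eq i)]
  fin_cases i
  · change IsBoundedAtImInfty (((1 / 2 : ℂ) • (thetaSqFun 1 + thetaSqFun 2)) ∣[(1 : ℤ)] γ)
    rw [SL_smul_slash, SlashAction.add_slash]
    exact (h1.add h2).const_mul_left _
  · exact h0
  · change IsBoundedAtImInfty
      (((1 / 2 : ℂ) • (thetaSqFun 1 + (-1 : ℂ) • thetaSqFun 2)) ∣[(1 : ℤ)] γ)
    rw [SL_smul_slash, SlashAction.add_slash, SL_smul_slash]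
    exact (h1.add (h2.const_mul_left _)).const_mul_left _

lemma mdifferentiable_baseFun (i : Fin 3) : MDiff (baseFun i) := by
  apply mdifferentiable_of_differentiableAt (f := baseForm i)
  intro z hz
  have h1 := differentiableAt_theta hz
  have h2 := differentiableAt_phi hz
  fin_cases i
  · exact h1.pow 2
  · exact (h1.const_mul 2).mul h2
  · exact h2.pow 2

lemma map_mapGL_le (Γ : Subgroup SL(2, ℤ)) : Γ.map (mapGL ℝ) ≤ 𝒮ℒ := by
  rintro _ ⟨γ, -, rfl⟩
  exact ⟨γ, rfl⟩

/-- The forms `M`, `N`, `P`, as modular forms on `Γ(4)`. -/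
noncomputable def baseModularForm (i : Fin 3) : ModularForm (Γ(4).map (mapGL ℝ)) 1 where
  toFun := baseFun i
  slash_action_eq' A hA := by
    obtain ⟨A, hA, rfl⟩ := hA
    exact baseFun_slash_of_mem hA i
  holo' := mdifferentiable_baseFun i
  bdd_at_cusps' hc := by
    rw [OnePoint.isBoundedAt_iff_forall_SL2Z (hc.mono (map_mapGL_le _))]
    exact fun γ _ => isBoundedAtImInfty_baseFun_slash i γ

/-! ### Integral matrices -/

/-- An integral matrix with positive determinant, as an element of `GL(2, ℝ)`. -/
noncomputable def intGL (α : Matrix (Fin 2) (Fin 2) ℤ) (h : 0 < α.det) : GL (Fin 2) ℝ :=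
  Matrix.GeneralLinearGroup.mkOfDetNeZero (α.map (Int.cast : ℤ → ℝ)) (by
    rw [show (α.map (Int.cast : ℤ → ℝ)).det = ((α.det : ℤ) : ℝ) from
      ((Int.castRingHom ℝ).map_det α).symm]
    exact_mod_cast h.ne')

lemma coe_intGL (α : Matrix (Fin 2) (Fin 2) ℤ) (h : 0 < α.det) :
    (intGL α h : Matrix (Fin 2) (Fin 2) ℝ) = α.map (Int.cast : ℤ → ℝ) := rfl

lemma det_intGL (α : Matrix (Fin 2) (Fin 2) ℤ) (h : 0 < α.det) :
    (intGL α h).det.val = (α.det : ℝ) := ((Int.castRingHom ℝ).map_det α).symm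

lemma intGL_mul_mapGL (α β : Matrix (Fin 2) (Fin 2) ℤ) (γ δ : SL(2, ℤ)) (hα : 0 < α.det)
    (hβ : 0 < β.det) (h : α * γ = δ * β) :
    intGL α hα * mapGL ℝ γ = mapGL ℝ δ * intGL β hβ := by
  apply Units.ext
  simp only [Units.val_mul, coe_intGL, mapGL_coe_matrix]
  have := congrArg (fun A : Matrix (Fin 2) (Fin 2) ℤ => A.map (Int.castRingHom ℝ)) h
  simp only [Matrix.map_mul] at this
  exact this

lemma intGL_eq_mul (α β : Matrix (Fin 2) (Fin 2) ℤ) (γ : SL(2, ℤ)) (hα : 0 < α.det)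
    (hβ : 0 < β.det) (h : β = α * γ) : intGL β hβ = intGL α hα * mapGL ℝ γ := by
  rw [intGL_mul_mapGL α β γ 1 hα hβ (by simp [h]), map_one, one_mul]

lemma slashOne_baseForm (i : Fin 3) (α : Matrix (Fin 2) (Fin 2) ℤ) (h : 0 < α.det) :
    slashOne (baseForm i) α = baseFun i ∣[(1 : ℤ)] intGL α h := by
  ext z
  have hpos : 0 < (intGL α h).det.val := by rw [det_intGL]; exact_mod_cast h
  rw [slash_apply, σ, if_pos hpos, sub_self, zpow_zero, mul_one, zpow_neg_one,
    baseFun, coe_smul_of_det_pos hpos]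
  rfl

lemma GammaPM_dvd {p : ℕ} {β : SL(2, ℤ)} (hβ : β ∈ GammaPM p) : ∃ ε : ℤ,
    ε ^ 2 = 1 ∧ ∀ i j, (p : ℤ) ∣ β i j - ε * (1 : Matrix (Fin 2) (Fin 2) ℤ) i j := by
  have key : ∀ (ε : ℤ) (i j : Fin 2), ((β i j : ℤ) : ZMod p) =
      (ε : ZMod p) * (1 : Matrix (Fin 2) (Fin 2) (ZMod p)) i j →
      (p : ℤ) ∣ β i j - ε * (1 : Matrix (Fin 2) (Fin 2) ℤ) i j := by
    intro ε i j h
    rw [← ZMod.intCast_zmod_eq_zero_iff_dvd]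
    push_cast
    rw [h, sub_eq_zero, Matrix.one_apply, Matrix.one_apply]
    split_ifs <;> simp
  rcases hβ.2 with h | h
  · refine ⟨1, by norm_num, fun i j => key 1 i j ?_⟩
    have := congrArg (fun A : SL(2, ZMod p) => A i j) h
    simpa using this
  · refine ⟨-1, by norm_num, fun i j => key (-1) i j ?_⟩
    have := congrArg (fun A : SL(2, ZMod p) => A i j) h
    simpa using this

/-- For `β` in `Γ_±(4p)` and an integral matrix `α` of determinant `1` or `p`, the matrix
`α β α⁻¹` lies in `Γ(4)`. -/
lemma exists_mul_eq_mul {p : ℕ} (hodd : Odd p) {β : SL(2, ℤ)} (hβ : β ∈ GammaPM p)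
    {α : Matrix (Fin 2) (Fin 2) ℤ} (hα : α.det = 1 ∨ α.det = p) :
    ∃ δ ∈ Γ(4), α * β = (δ : Matrix (Fin 2) (Fin 2) ℤ) * α := by
  have hp0 : (p : ℤ) ≠ 0 := by
    rintro h
    rw [Int.natCast_eq_zero] at h
    subst h
    exact absurd hodd (by decide)
  have hdet0 : α.det ≠ 0 := by rcases hα with h | h <;> rw [h] <;> simp_all
  have hdetodd : Odd α.det := by
    rcases hα with h | h <;> rw [h]
    · exact odd_one
    · exact_mod_cast hodd
  -- D is αβα⁻¹. When det α = p it is integral because β = ε + pB, with the scalar ε commuting past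
  -- α.
  have hD : ∃ D : Matrix (Fin 2) (Fin 2) ℤ, α.det • D = α * β * α.adjugate := by
    rcases hα with h | h
    · exact ⟨_, by rw [h, one_smul]⟩
    · obtain ⟨ε, -, hε⟩ := GammaPM_dvd hβ
      choose B hB using hε
      have hβB : (β : Matrix (Fin 2) (Fin 2) ℤ) = ε • 1 + (p : ℤ) • Matrix.of B := by
        ext i j
        simp only [Matrix.add_apply, Matrix.smul_apply, smul_eq_mul, Matrix.of_apply]
        linarith [hB i j]
      refine ⟨ε • 1 + α * Matrix.of B * α.adjugate, ?_⟩
      rw [hβB, Matrix.mul_add, Matrix.add_mul, Matrix.mul_smul, Matrix.mul_smul, Matrix.smul_mul,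
        Matrix.smul_mul, Matrix.mul_one, Matrix.mul_adjugate, smul_add, smul_comm, h]
  obtain ⟨D, hD⟩ := hD
  have hDα : α * β = D * α := by
    have : α.det • (α * (β : Matrix (Fin 2) (Fin 2) ℤ)) = α.det • (D * α) := by
      rw [show α.det • (D * α) = (α.det • D) * α from (Matrix.smul_mul _ _ _).symm, hD,
        Matrix.mul_assoc, Matrix.adjugate_mul, Matrix.mul_smul,
        Matrix.mul_one]
    exact smul_right_injective _ hdet0 this
  have hdetD : D.det = 1 := by
    have := congrArg Matrix.det hDα
    rw [Matrix.det_mul, Matrix.det_mul, β.det_coe, mul_one] at this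
    exact (mul_right_cancel₀ hdet0 (by rw [one_mul]; exact this)).symm
  refine ⟨⟨D, hdetD⟩, ?_, hDα⟩
  have h4 : ∃ C : Matrix (Fin 2) (Fin 2) ℤ, (β : Matrix (Fin 2) (Fin 2) ℤ) = 1 + (4 : ℤ) • C := by
    obtain ⟨⟨a, ha⟩, ⟨b, hb⟩, ⟨c, hc⟩, ⟨d, hd⟩⟩ := Gamma_four_iff.mp hβ.1
    refine ⟨!![a, b; c, d], ?_⟩
    ext i j
    fin_cases i <;> fin_cases j <;> simp <;> linarith
  obtain ⟨C, hC⟩ := h4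
  -- As det α is odd, it can be cancelled modulo 4, giving D ≡ 1 mod 4.
  have h5 : α.det • (D - 1) = (4 : ℤ) • (α * C * α.adjugate) := by
    rw [smul_sub, hD, hC, Matrix.mul_add, Matrix.add_mul, Matrix.mul_one, Matrix.mul_adjugate,
      Matrix.mul_smul, Matrix.smul_mul, add_sub_cancel_left]
  have h6 : ∀ i j, (4 : ℤ) ∣ (D - 1) i j := by
    intro i j
    have := congrFun (congrFun h5 i) j
    simp only [Matrix.smul_apply, smul_eq_mul] at this
    have hcop : IsCoprime (4 : ℤ) α.det := by
      rw [show (4 : ℤ) = 2 ^ 2 by norm_num]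
      exact (Int.isCoprime_two_left.mpr hdetodd).pow_left
    exact hcop.dvd_of_dvd_mul_left ⟨_, this⟩
  refine Gamma_four_iff.mpr ⟨?_, ?_, ?_, ?_⟩
  · simpa using h6 0 0
  · simpa using h6 0 1
  · simpa using h6 1 0
  · simpa using h6 1 1

/-! ### The elements of `V` are modular forms -/

/-- The restriction of a modular form to a smaller group. -/
def restrictModularForm {Γ Γ' : Subgroup (GL (Fin 2) ℝ)} {k : ℤ} (h : Γ' ≤ Γ)
    (f : ModularForm Γ k) : ModularForm Γ' k where
  toFun := f
  slash_action_eq' A hA := SlashInvariantFormClass.slash_action_eq f A (h hA)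
  holo' := ModularFormClass.holo f
  bdd_at_cusps' hc := ModularFormClass.bdd_at_cusps f (hc.mono h)

lemma GammaPMReal_le_conj {p : ℕ} (hodd : Odd p) {α : Matrix (Fin 2) (Fin 2) ℤ}
    (hα : α.det = 1 ∨ α.det = p) (h : 0 < α.det) :
    GammaPMReal p ≤ ConjAct.toConjAct (intGL α h)⁻¹ • Γ(4).map (mapGL ℝ) := by
  rintro _ ⟨β, hβ, rfl⟩
  obtain ⟨δ, hδ, hδα⟩ := exists_mul_eq_mul hodd hβ hα
  rw [Subgroup.mem_pointwise_smul_iff_inv_smul_mem, ← ConjAct.toConjAct_inv, inv_inv,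
    ConjAct.toConjAct_smul]
  refine ⟨δ, hδ, ?_⟩
  rw [intGL_mul_mapGL α α β δ h h hδα, mul_inv_cancel_right]

lemma det_pos_of {p : ℕ} (hp : p.Prime) {α : Matrix (Fin 2) (Fin 2) ℤ}
    (hα : α.det = 1 ∨ α.det = p) : 0 < α.det := by
  rcases hα with h | h <;> rw [h]
  · exact one_pos
  · exact_mod_cast hp.pos

instance hasDetOne_map_mapGL (Γ : Subgroup SL(2, ℤ)) : (Γ.map (mapGL ℝ)).HasDetOne where
  det_eq := by
    rintro _ ⟨γ, -, rfl⟩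
    simp

/-- The elements of `V` are modular forms of weight one on `Γ_±(4p)`. -/
lemma exists_modularForm_of_mem_V {p : ℕ} (hp : p.Prime) (hodd : Odd p) {g : ℍ → ℂ}
    (hg : g ∈ V p) : ∃ G : ModularForm (GammaPMReal p) 1, ⇑G = g := by
  induction hg using Submodule.span_induction with
  | mem g hg =>
    obtain ⟨i, α, hα, rfl⟩ := hg
    have h := det_pos_of hp hα
    refine ⟨restrictModularForm (GammaPMReal_le_conj hodd hα h)
      (ModularForm.translate (baseModularForm i) (intGL α h)), ?_⟩
    rw [slashOne_baseForm i α h]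
    rfl
  | zero => exact ⟨0, rfl⟩
  | add f g _ _ hf hg =>
    obtain ⟨F, rfl⟩ := hf
    obtain ⟨G, rfl⟩ := hg
    exact ⟨F + G, rfl⟩
  | smul c f _ hf =>
    obtain ⟨F, rfl⟩ := hf
    exact ⟨c • F, rfl⟩

/-! ### Cusp functions with a simple zero -/

lemma tendsto_zero_of_tendsto_div_qParam {f : ℍ → ℂ} {h : ℝ} {c : ℂ} (hh : 0 < h)
    (hf : Tendsto (fun z : ℍ => f z / Function.Periodic.qParam h z) atImInfty (𝓝 c)) :
    Tendsto f atImInfty (𝓝 0) := by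
  have := hf.mul (qParam_tendsto_atImInfty hh)
  rw [mul_zero] at this
  refine this.congr fun z => ?_
  rw [div_mul_cancel₀ _ (Function.Periodic.qParam_ne_zero (z : ℂ))]

/-- The limit of f/q is the difference quotient at 0 of the extended function of q. Thus asymptotics
alone detect a simple zero at a cusp. -/
lemma cuspFunction_of_tendsto_div_qParam {f : ℍ → ℂ} {h : ℝ} {c : ℂ} (hh : 0 < h)
    (hper : Function.Periodic (f ∘ ofComplex) h) (hhol : MDiff f)
    (hf : Tendsto (fun z : ℍ => f z / Function.Periodic.qParam h z) atImInfty (𝓝 c)) :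
    AnalyticAt ℂ (cuspFunction h f) 0 ∧ cuspFunction h f 0 = 0 ∧
      deriv (cuspFunction h f) 0 = c := by
  have h0 : IsZeroAtImInfty f := tendsto_zero_of_tendsto_div_qParam hh hf
  have han := analyticAt_cuspFunction_zero hh hper hhol h0.boundedAtFilter
  have hval : cuspFunction h f 0 = 0 := by
    rw [cuspFunction_apply_zero hh han hper, h0.valueAtInfty_eq_zero]
  refine ⟨han, hval, ?_⟩
  have hd := hasDerivAt_iff_tendsto_slope_zero.mp han.differentiableAt.hasDerivAt
  have hq := (Function.Periodic.qParam_tendsto hh).comp tendsto_coe_atImInfty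
  refine tendsto_nhds_unique ((hd.comp hq).congr fun z => ?_) hf
  simp only [Function.comp_apply, zero_add, hval, sub_zero, smul_eq_mul]
  rw [eq_cuspFunction z hh.ne' hper, div_eq_inv_mul]

/-! ### The action of `SL(2, ℤ)` on the Hauptmodul -/

lemma hauptmodul_T_smul (z : ℍ) :
    hauptmodul (T • z : ℍ) = Complex.I * hauptmodul z := by
  rw [modular_T_smul, coe_vadd, ← hauptmodul_add_one z.im_pos]
  simp [add_comm]

lemma hauptmodul_S_smul (z : ℍ) :
    hauptmodul (S • z : ℍ) = (1 - hauptmodul z) / (1 + hauptmodul z) := by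
  rw [← hauptmodul_neg_inv z.im_pos, modular_S_smul]
  congr 1
  simp [neg_div, inv_neg]

lemma norm_hauptmodul_T_smul (z : ℍ) : ‖hauptmodul (T • z : ℍ)‖ = ‖hauptmodul z‖ := by
  rw [hauptmodul_T_smul, norm_mul, Complex.norm_I, one_mul]

lemma norm_hauptmodul_T_zpow_smul (n : ℤ) (z : ℍ) :
    ‖hauptmodul (T ^ n • z : ℍ)‖ = ‖hauptmodul z‖ := by
  induction n generalizing z with
  | zero => simp
  | succ n ih => rw [zpow_add_one, mul_smul, ih, norm_hauptmodul_T_smul]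
  | pred n ih =>
    rw [zpow_sub_one, mul_smul, ih, ← norm_hauptmodul_T_smul, smul_inv_smul]

/-- T² acts on r by r ↦ -r and S by the involution r ↦ (1-r)/(1+r); conjugating the first by the
second gives r ↦ 1/r. -/
lemma hauptmodul_lowerTwo_smul (z : ℍ) :
    hauptmodul (lowerTwo • z : ℍ) = (hauptmodul z)⁻¹ := by
  obtain ⟨w, rfl⟩ : ∃ w, z = S • w := ⟨S⁻¹ • z, (smul_inv_smul _ _).symm⟩
  have h1 := one_add_hauptmodul_ne_zero w
  have h2 := one_sub_hauptmodul_ne_zero w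
  rw [lowerTwo, mul_smul, inv_smul_smul, mul_smul, hauptmodul_S_smul, pow_two, mul_smul,
    hauptmodul_T_smul, hauptmodul_T_smul, ← mul_assoc, Complex.I_mul_I, hauptmodul_S_smul]
  rw [neg_one_mul, sub_neg_eq_add, ← sub_eq_add_neg, inv_div]

lemma baseFun_smul_of_mem {γ : SL(2, ℤ)} (hγ : γ ∈ Γ(4)) (i : Fin 3) (z : ℍ) :
    baseFun i (γ • z) = baseFun i z * (γ 1 0 * z + γ 1 1) := by
  have h := congrFun (baseFun_slash_of_mem hγ i) z
  have hd : denom γ z ≠ 0 := denom_ne_zero _ z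
  rw [SL_slash_apply, zpow_neg_one] at h
  rw [← denom_apply, ← h, inv_mul_cancel_right₀ hd]

lemma hauptmodul_eq_div (z : ℍ) : hauptmodul z = baseFun 1 z / (2 * baseFun 0 z) := by
  have := theta_ne_zero z
  simp only [hauptmodul, baseFun, baseForm, Matrix.cons_val]
  field_simp

lemma hauptmodul_smul_of_mem {γ : SL(2, ℤ)} (hγ : γ ∈ Γ(4)) (z : ℍ) :
    hauptmodul (γ • z : ℍ) = hauptmodul z := by
  have hd : (γ 1 0 * z + γ 1 1 : ℂ) ≠ 0 := by
    rw [← denom_apply]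
    exact denom_ne_zero _ z
  rw [hauptmodul_eq_div, hauptmodul_eq_div, baseFun_smul_of_mem hγ, baseFun_smul_of_mem hγ,
    ← mul_assoc, mul_div_mul_right _ _ hd]

/-- A function on the plane whose composition with the Hauptmodul is invariant under
`SL(2, ℤ)`. -/
noncomputable def height (w : ℂ) : ℝ := ‖w * (1 - w ^ 4)‖ / (1 + ‖w‖ ^ 2) ^ 3

lemma continuous_height : Continuous height := by
  refine Continuous.div (by fun_prop) (by fun_prop) fun w => ?_
  positivity

lemma height_zero : height 0 = 0 := by simp [height]

lemma continuous_SL_smul (γ : SL(2, ℤ)) : Continuous fun z : ℍ => γ • z :=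
  continuous_const_smul (mapGL ℝ γ)

lemma height_pos {w : ℂ} (hw : w * (1 - w ^ 4) ≠ 0) : 0 < height w :=
  div_pos (norm_pos_iff.mpr hw) (by positivity)

lemma height_I_mul (w : ℂ) : height (Complex.I * w) = height w := by
  rw [height, height, mul_pow, Complex.I_pow_four, one_mul, mul_assoc, norm_mul,
    norm_mul Complex.I w, Complex.norm_I, one_mul, one_mul]

/-- By the parallelogram law 1 + |w|² acquires the factor 2/|1+w|². Its cube matches the factor
8/|1+w|⁶ of the sextic. -/
lemma height_cayley {w : ℂ} (hw : 1 + w ≠ 0) : height ((1 - w) / (1 + w)) = height w := by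
  have h1 : (1 - w) / (1 + w) * (1 - ((1 - w) / (1 + w)) ^ 4) =
      8 * (w * (1 - w ^ 4)) / (1 + w) ^ 6 := by
    field_simp
    ring
  have hn : ‖1 + w‖ ^ 2 ≠ 0 := pow_ne_zero _ (norm_ne_zero_iff.mpr hw)
  have h2 : 1 + ‖(1 - w) / (1 + w)‖ ^ 2 = 2 * (1 + ‖w‖ ^ 2) / ‖1 + w‖ ^ 2 := by
    have hp := parallelogram_law_with_norm ℝ 1 w
    rw [norm_div, div_pow, eq_div_iff hn, add_mul, div_mul_cancel₀ _ hn]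
    simp only [norm_one] at hp
    linarith
  have hs : (1 + ‖w‖ ^ 2) ≠ 0 := by positivity
  have hn' : ‖1 + w‖ ≠ 0 := norm_ne_zero_iff.mpr hw
  rw [height, h1, h2, height, norm_div, norm_mul, norm_pow]
  simp only [Complex.norm_ofNat]
  field_simp
  ring

lemma height_hauptmodul_smul (γ : SL(2, ℤ)) (z : ℍ) :
    height (hauptmodul (γ • z : ℍ)) = height (hauptmodul z) := by
  have hT : ∀ z : ℍ, height (hauptmodul (T • z : ℍ)) = height (hauptmodul z) := fun z => by
    rw [hauptmodul_T_smul, height_I_mul]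
  have hS : ∀ z : ℍ, height (hauptmodul (S • z : ℍ)) = height (hauptmodul z) := fun z => by
    rw [hauptmodul_S_smul, height_cayley (one_add_hauptmodul_ne_zero z)]
  have hγ : γ ∈ Subgroup.closure {S, T} := by
    simp [_root_.SpecialLinearGroup.SL2Z_generators]
  induction hγ using Subgroup.closure_induction generalizing z with
  | mem γ hγ =>
    rcases hγ with rfl | rfl
    · exact hS z
    · exact hT z
  | one => rw [one_smul]
  | mul γ δ _ _ hγ hδ => rw [mul_smul, hγ, hδ]
  | inv γ _ hγ => rw [← hγ, smul_inv_smul]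

lemma continuous_hauptmodul : Continuous fun z : ℍ => hauptmodul z :=
  continuous_iff_continuousAt.mpr fun z =>
    ContinuousAt.comp (f := ((↑) : ℍ → ℂ)) (differentiableAt_hauptmodul z.im_pos).continuousAt
      continuous_coe.continuousAt

/-- Modulo `Γ(4)`, the Hauptmodul is proper as a map to the plane without its omitted values. -/
lemma exists_isCompact_of_le_height {c : ℝ} (hc : 0 < c) : ∃ K : Set ℍ, IsCompact K ∧
    ∀ z : ℍ, c ≤ height (hauptmodul z) → ∃ γ ∈ Γ(4), γ • z ∈ K := by
  have ht : Tendsto (fun z : ℍ => height (hauptmodul z)) atImInfty (𝓝 0) := by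
    have := (continuous_height.tendsto 0).comp tendsto_hauptmodul
    rwa [height_zero] at this
  have hev := ht.eventually (gt_mem_nhds hc)
  obtain ⟨Y, hY⟩ := (atImInfty_mem _).mp hev
  -- A finite union of translates of a truncated fundamental domain. The truncation is harmless:
  -- above Y the invariant `height` is smaller than c.
  refine ⟨⋃ q : SL(2, ℤ) ⧸ Γ(4), (fun z : ℍ => (Quotient.out q)⁻¹ • z) ''
    truncatedFundamentalDomain Y, ?_, fun z hz => ?_⟩
  · exact isCompact_iUnion fun q =>
      (isCompact_truncatedFundamentalDomain Y).image (continuous_SL_smul _)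
  · obtain ⟨g, hg⟩ := exists_smul_mem_fd z
    obtain ⟨γ, hγ⟩ := QuotientGroup.mk_out_eq_mul Γ(4) g
    refine ⟨(γ : SL(2, ℤ))⁻¹, inv_mem γ.2, ?_⟩
    rw [Set.mem_iUnion]
    refine ⟨(g : SL(2, ℤ) ⧸ Γ(4)), g • z, ⟨hg, ?_⟩, ?_⟩
    · by_contra! h
      have := hY (g • z) h.le
      simp only [Set.mem_ofPred_eq, height_hauptmodul_smul] at this
      linarith
    · simp only [hγ, mul_inv_rev, mul_smul, inv_smul_smul]

/-! ### The Hauptmodul near infinity -/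

lemma T_zpow_mem_Gamma_four_iff (n : ℤ) : T ^ n ∈ Γ(4) ↔ (4 : ℤ) ∣ n := by
  rw [Gamma_four_iff]
  simp [coe_T_zpow]

lemma mem_Gamma_four_mul_T_zpow {h : SL(2, ℤ)} (hc : (4 : ℤ) ∣ h 1 0) :
    ∃ γ ∈ Γ(4), ∃ j : ℤ, h = γ * T ^ j ∨ h = -(γ * T ^ j) := by
  have hdet := h.det_coe
  rw [Matrix.det_fin_two] at hdet
  obtain ⟨c, hc⟩ := hc
  rw [hc] at hdet
  set a := h 0 0 with ha
  set b := h 0 1 with hb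
  set d := h 1 1 with hd
  have key : ((4 : ℤ) ∣ a - 1 ∧ (4 : ℤ) ∣ d - 1) ∨ ((4 : ℤ) ∣ a + 1 ∧ (4 : ℤ) ∣ d + 1) := by
    have h1 : (a * d) % 4 = 1 := by
      have : a * d = 1 + 4 * (b * c) := by linarith
      omega
    rw [Int.mul_emod] at h1
    have ha4 := Int.emod_nonneg a (by norm_num : (4 : ℤ) ≠ 0)
    have ha4' := Int.emod_lt_of_pos a (by norm_num : (0 : ℤ) < 4)
    have hd4 := Int.emod_nonneg d (by norm_num : (4 : ℤ) ≠ 0)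
    have hd4' := Int.emod_lt_of_pos d (by norm_num : (0 : ℤ) < 4)
    generalize hx : a % 4 = x at *
    generalize hy : d % 4 = y at *
    interval_cases x <;> interval_cases y <;> simp at h1 <;> omega
  -- The exponent -ab turns the upper right entry into b(1 - a²), divisible by 4 as a is odd.
  have hT : (T ^ (-(a * b)) : SL(2, ℤ)) = (!![1, -(a * b); 0, 1] : Matrix (Fin 2) (Fin 2) ℤ) :=
    coe_T_zpow _
  have hm : ((h * T ^ (-(a * b)) : SL(2, ℤ)) : Matrix (Fin 2) (Fin 2) ℤ) =
      !![a, b - a * a * b; 4 * c, d - 4 * c * (a * b)] := by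
    rw [Matrix.SpecialLinearGroup.coe_mul, hT, Matrix.eta_fin_two (h : Matrix (Fin 2) (Fin 2) ℤ),
      ← ha, ← hb, ← hd, hc]
    ext i j
    fin_cases i <;> fin_cases j <;> simp [Matrix.mul_apply] <;> ring
  rcases key with ⟨⟨u, hu⟩, ⟨v, hv⟩⟩ | ⟨⟨u, hu⟩, ⟨v, hv⟩⟩
  · refine ⟨h * T ^ (-(a * b)), ?_, a * b, Or.inl ?_⟩
    · rw [Gamma_four_iff, hm]
      refine ⟨⟨u, ?_⟩, ⟨-(2 * u + 4 * u ^ 2) * b, ?_⟩, ⟨c, ?_⟩, ⟨v - c * (a * b), ?_⟩⟩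
      · simp [hu]
      · have : a = 1 + 4 * u := by linarith
        simp [this]
        ring
      · simp
      · simp
        linarith
    · rw [mul_assoc, ← zpow_add, neg_add_cancel, zpow_zero, mul_one]
  · refine ⟨-(h * T ^ (-(a * b))), ?_, a * b, Or.inr ?_⟩
    · rw [Gamma_four_iff, Matrix.SpecialLinearGroup.coe_neg, hm]
      refine ⟨⟨-u, ?_⟩, ⟨-(2 * u - 4 * u ^ 2) * b, ?_⟩, ⟨-c, ?_⟩, ⟨-v + c * (a * b), ?_⟩⟩
      · simp
        linarith
      · have : a = -1 + 4 * u := by linarith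
        simp [this]
        ring
      · simp
      · simp
        linarith
    · rw [neg_mul, neg_neg, mul_assoc, ← zpow_add, neg_add_cancel, zpow_zero, mul_one]

lemma exists_smul_eq_T_zpow_smul {h : SL(2, ℤ)} (hc : (4 : ℤ) ∣ h 1 0) :
    ∃ γ ∈ Γ(4), ∃ j : ℤ, ∀ z : ℍ, h • z = γ • T ^ j • z := by
  obtain ⟨γ, hγ, j, h | h⟩ := mem_Gamma_four_mul_T_zpow hc
  · exact ⟨γ, hγ, j, fun z => by rw [h, mul_smul]⟩
  · exact ⟨γ, hγ, j, fun z => by rw [h, SL_neg_smul, mul_smul]⟩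

lemma norm_hauptmodul_smul_of_dvd {h : SL(2, ℤ)} (hc : (4 : ℤ) ∣ h 1 0) (z : ℍ) :
    ‖hauptmodul (h • z : ℍ)‖ = ‖hauptmodul z‖ := by
  obtain ⟨γ, hγ, j, h⟩ := exists_smul_eq_T_zpow_smul hc
  rw [h, hauptmodul_smul_of_mem hγ, norm_hauptmodul_T_zpow_smul]

lemma one_third_le_norm_cayley {w : ℂ} (hw : ‖w‖ ≤ 1 / 2) : 1 / 3 ≤ ‖(1 - w) / (1 + w)‖ := by
  have h1 : 1 / 2 ≤ ‖1 - w‖ := by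
    have := norm_sub_norm_le (1 : ℂ) w
    rw [norm_one] at this
    linarith
  have h2 : ‖1 + w‖ ≤ 3 / 2 := by
    have := norm_add_le (1 : ℂ) w
    rw [norm_one] at this
    linarith
  have h3 : 0 < ‖1 + w‖ := by
    have := norm_sub_norm_le (1 : ℂ) (-w)
    rw [norm_one, norm_neg, sub_neg_eq_add] at this
    linarith
  rw [norm_div, le_div_iff₀ h3]
  linarith

/-- If the Hauptmodul is small at `z` and at `h z`, then `h` fixes the cusp at infinity up to an
element of `Γ(4)`. -/
lemma dvd_of_norm_hauptmodul_lt {h : SL(2, ℤ)} {z : ℍ} (hz : ‖hauptmodul z‖ ≤ 1 / 2)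
    (hhz : ‖hauptmodul (h • z : ℍ)‖ < 1 / 3) : (4 : ℤ) ∣ h 1 0 := by
  have hdet := h.det_coe
  rw [Matrix.det_fin_two] at hdet
  rcases Int.even_or_odd (h 1 0) with ⟨c, hc⟩ | hodd
  · by_contra hcon
    -- When the lower left entry is 2 mod 4, `lowerTwo⁻¹ * h` fixes infinity up to Γ(4), so |r(hz)|
    -- = 1/|r(z)| ≥ 2.
    have hcodd : Odd c := by
      rcases Int.even_or_odd c with ⟨k, hk⟩ | h
      · exact absurd ⟨k, by linarith⟩ hcon
      · exact h
    have haodd : Odd (h 0 0) := by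
      rcases Int.even_or_odd (h 0 0) with ⟨k, hk⟩ | h'
      · rw [hk, hc] at hdet
        have : 2 * (k * h 1 1 - h 0 1 * c) = 1 := by linarith
        omega
      · exact h'
    have hdvd : (4 : ℤ) ∣ (lowerTwo⁻¹ * h) 1 0 := by
      have : (lowerTwo⁻¹ * h) 1 0 = 2 * h 0 0 + h 1 0 := by
        rw [Matrix.SpecialLinearGroup.coe_mul, Matrix.SpecialLinearGroup.coe_inv, coe_lowerTwo]
        simp [Matrix.adjugate_fin_two, Matrix.mul_apply]
      obtain ⟨k, hk⟩ := hcodd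
      obtain ⟨l, hl⟩ := haodd
      exact ⟨k + l + 1, by rw [this]; linarith⟩
    have h1 := norm_hauptmodul_smul_of_dvd hdvd z
    have h2 := hauptmodul_lowerTwo_smul ((lowerTwo⁻¹ * h) • z)
    rw [mul_smul, smul_inv_smul] at h2
    rw [mul_smul] at h1
    rw [h2, norm_inv, h1] at hhz
    have hpos : 0 < ‖hauptmodul z‖ := norm_pos_iff.mpr (hauptmodul_ne_zero z)
    have : (1 / 2 : ℝ)⁻¹ ≤ ‖hauptmodul z‖⁻¹ := inv_anti₀ hpos hz
    norm_num at this
    linarith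
  · exfalso
    -- With a, c the first column of h and c odd, a - mc = a(1 - c²) is divisible by 4. So h is T^m
    -- S up to an element that preserves |r|, and |r(hz)| is the norm of a Cayley transform of a
    -- small number.
    set m := h 0 0 * h 1 0 with hm
    have hdvd : (4 : ℤ) ∣ (S⁻¹ * (T ^ (-m) * h)) 1 0 := by
      have hT : (T ^ (-m) : SL(2, ℤ)) = (!![1, -m; 0, 1] : Matrix (Fin 2) (Fin 2) ℤ) :=
        coe_T_zpow _
      have : (S⁻¹ * (T ^ (-m) * h)) 1 0 = -(h 0 0 + -m * h 1 0) := by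
        rw [Matrix.SpecialLinearGroup.coe_mul, Matrix.SpecialLinearGroup.coe_mul,
          Matrix.SpecialLinearGroup.coe_inv, hT, coe_S]
        simp [Matrix.adjugate_fin_two, Matrix.mul_apply, Matrix.vecMul, dotProduct]
      rw [this, hm]
      obtain ⟨k, hk⟩ := hodd
      exact ⟨h 0 0 * (k ^ 2 + k), by rw [hk]; ring⟩
    have h1 := norm_hauptmodul_smul_of_dvd hdvd z
    have h2 := norm_hauptmodul_T_zpow_smul (-m) (h • z)
    have h3 := hauptmodul_S_smul ((S⁻¹ * (T ^ (-m) * h)) • z)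
    rw [mul_smul, smul_inv_smul, mul_smul] at h3
    rw [h3] at h2
    have := one_third_le_norm_cayley (h1.trans_le hz)
    rw [mul_smul, mul_smul] at this
    linarith

/-- Where the Hauptmodul is small, an element of `Γ(4)` moves the point close to infinity. -/
lemma exists_lt_im_of_norm_hauptmodul_lt (Y : ℝ) : ∃ ε > 0, ∀ z : ℍ, ‖hauptmodul z‖ < ε →
    ∃ γ ∈ Γ(4), Y < (γ • z).im := by
  obtain ⟨Y', hY'⟩ := (atImInfty_mem _).mp
    (tendsto_hauptmodul.norm (Iic_mem_nhds (by simp : ‖(0 : ℂ)‖ < 1 / 2)))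
  -- On the compact part of the fundamental domain `height` has a positive minimum. A point with
  -- smaller `height` therefore reduces to one high up.
  obtain ⟨m, hm, hm'⟩ : ∃ m > 0, ∀ z ∈ truncatedFundamentalDomain (max Y Y'),
      m ≤ height (hauptmodul z) := by
    rcases (truncatedFundamentalDomain (max Y Y')).eq_empty_or_nonempty with he | hne
    · exact ⟨1, one_pos, by simp [he]⟩
    · obtain ⟨z, -, hz⟩ := (isCompact_truncatedFundamentalDomain (max Y Y')).exists_isMinOn hne
        (continuous_height.comp continuous_hauptmodul).continuousOn
      exact ⟨_, height_pos (hauptmodul_mul_ne_zero z), fun w hw => hz hw⟩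
  have hh : Tendsto height (𝓝 0) (𝓝 0) := by
    simpa only [height_zero] using continuous_height.tendsto 0
  obtain ⟨ε, hε, hε'⟩ := Metric.eventually_nhds_iff.mp (hh.eventually (gt_mem_nhds hm))
  refine ⟨min ε (1 / 3), by positivity, fun z hz => ?_⟩
  obtain ⟨g, hg⟩ := exists_smul_mem_fd z
  have hlt : height (hauptmodul z) < m :=
    hε' (by rw [dist_zero_right]; exact hz.trans_le (min_le_left _ _))
  have him : max Y Y' < (g • z).im := by
    by_contra! h
    have := hm' (g • z) ⟨hg, h⟩
    rw [height_hauptmodul_smul] at this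
    linarith
  -- r is small both at gz, which is high up, and at z, so g⁻¹ can only be a translation, up to Γ(4)
  -- and sign.
  have hdvd : (4 : ℤ) ∣ g⁻¹ 1 0 := by
    refine dvd_of_norm_hauptmodul_lt (z := g • z) ?_ ?_
    · exact hY' _ ((le_max_right _ _).trans him.le)
    · rw [inv_smul_smul]
      exact hz.trans_le (min_le_right _ _)
  obtain ⟨γ, hγ, j, h⟩ := exists_smul_eq_T_zpow_smul hdvd
  refine ⟨γ⁻¹, inv_mem hγ, ?_⟩
  have := h (g • z)
  rw [inv_smul_smul] at this
  rw [this, inv_smul_smul]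
  have him' : (T ^ j • g • z).im = (g • z).im := by
    rw [← coe_im, coe_T_zpow_smul_eq]
    simp
  rw [him']
  exact (le_max_left _ _).trans_lt him

lemma hauptmodul_add_four {z : ℂ} (hz : 0 < z.im) : hauptmodul (z + 4) = hauptmodul z := by
  have h : ∀ w : ℂ, 0 < w.im → hauptmodul (w + 2) = -hauptmodul w := fun w hw => by
    rw [show w + 2 = w + 1 + 1 by ring, hauptmodul_add_one (by simpa using hw),
      hauptmodul_add_one hw, ← mul_assoc, Complex.I_mul_I, neg_one_mul]
  rw [show z + 4 = z + 2 + 2 by ring, h _ (by simpa using hz), h _ hz, neg_neg]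

lemma periodic_comp_ofComplex_of {f : ℂ → ℂ} {h : ℝ} (hf : ∀ z : ℂ, 0 < z.im → f (z + h) = f z) :
    Function.Periodic ((fun z : ℍ => f z) ∘ ofComplex) h := by
  intro w
  by_cases! hw : 0 < w.im
  · have : 0 < (w + h).im := by simpa using hw
    simp only [Function.comp_apply, ofComplex_apply_of_im_pos this, ofComplex_apply_of_im_pos hw]
    exact hf w hw
  · have : (w + h).im ≤ 0 := by simpa using hw
    simp only [Function.comp_apply, ofComplex_apply_of_im_nonpos this,
      ofComplex_apply_of_im_nonpos hw]

/-- Close to infinity, the Hauptmodul is injective up to translations by multiples of `4`. -/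
lemma exists_hauptmodul_inj_of_lt_im : ∃ Y : ℝ, ∀ z w : ℍ, Y < z.im → Y < w.im →
    hauptmodul z = hauptmodul w → ∃ n : ℤ, (z : ℂ) = w + 4 * n := by
  have hper : Function.Periodic ((fun z : ℍ => hauptmodul z) ∘ ofComplex) (4 : ℝ) :=
    periodic_comp_ofComplex_of fun z hz => by simpa using hauptmodul_add_four hz
  have hq : ∀ z : ℂ, Function.Periodic.qParam 4 z = Complex.exp (Real.pi * Complex.I * z / 2) :=
    fun z => by
      rw [Function.Periodic.qParam]
      congr 1
      push_cast
      ring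
  obtain ⟨han, -, hd⟩ := cuspFunction_of_tendsto_div_qParam (by norm_num : (0 : ℝ) < 4) hper
    (mdifferentiable_of_differentiableAt fun z hz => differentiableAt_hauptmodul hz) (c := 2)
    (by simp only [hq]; exact tendsto_hauptmodul_div)
  have hs : HasStrictDerivAt _ _ _ := han.hasStrictDerivAt
  -- As a function of q^{1/4}, r has derivative 2 at 0, so r determines q^{1/4} near the cusp.
  have hinj := (hs.hasStrictFDerivAt_equiv (by rw [hd]; norm_num)).eventually_left_inverse
  obtain ⟨Y, hY⟩ := (atImInfty_mem _).mp
    ((qParam_tendsto_atImInfty (by norm_num : (0 : ℝ) < 4)).eventually hinj)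
  refine ⟨Y, fun z w hz hw h => ?_⟩
  have h1 := hY z hz.le
  have h2 := hY w hw.le
  simp only [Set.mem_ofPred_eq, eq_cuspFunction _ (by norm_num : (4 : ℝ) ≠ 0) hper] at h1 h2
  rw [h, h2, Function.Periodic.qParam, Function.Periodic.qParam,
    Complex.exp_eq_exp_iff_exists_int] at h1
  obtain ⟨n, hn⟩ := h1
  refine ⟨-n, ?_⟩
  have h3 : (2 * Real.pi * Complex.I : ℂ) ≠ 0 := Complex.two_pi_I_ne_zero
  apply mul_left_cancel₀ h3
  push_cast at hn ⊢
  linear_combination -4 * hn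

lemma exists_hauptmodul_inj_of_norm_lt : ∃ ε > 0, ∀ z w : ℍ, ‖hauptmodul z‖ < ε →
    hauptmodul z = hauptmodul w → ∃ γ ∈ Γ(4), γ • z = w := by
  obtain ⟨Y, hY⟩ := exists_hauptmodul_inj_of_lt_im
  obtain ⟨ε, hε, h⟩ := exists_lt_im_of_norm_hauptmodul_lt Y
  refine ⟨ε, hε, fun z w hz hzw => ?_⟩
  obtain ⟨γ, hγ, hγz⟩ := h z hz
  obtain ⟨δ, hδ, hδw⟩ := h w (hzw ▸ hz)
  obtain ⟨n, hn⟩ := hY _ _ hδw hγz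
    (by rw [hauptmodul_smul_of_mem hγ, hauptmodul_smul_of_mem hδ, hzw])
  have hT : T ^ (4 * n) ∈ Γ(4) := (T_zpow_mem_Gamma_four_iff _).mpr ⟨n, rfl⟩
  refine ⟨δ⁻¹ * T ^ (4 * n) * γ, mul_mem (mul_mem (inv_mem hδ) hT) hγ, ?_⟩
  rw [mul_smul, mul_smul, inv_smul_eq_iff]
  ext1
  rw [coe_T_zpow_smul_eq, hn]
  push_cast
  ring

/-! ### The Hauptmodul is injective modulo `Γ(4)` -/

lemma hasStrictDerivAt_hauptmodul {z : ℂ} (hz : 0 < z.im) :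
    HasStrictDerivAt hauptmodul (deriv hauptmodul z) z := by
  have : DifferentiableOn ℂ hauptmodul upperHalfPlaneSet := fun w hw =>
    (differentiableAt_hauptmodul hw).differentiableWithinAt
  exact (this.analyticAt (isOpen_upperHalfPlaneSet.mem_nhds hz)).hasStrictDerivAt

lemma map_nhds_coe (z : ℍ) : map ((↑) : ℍ → ℂ) (𝓝 z) = 𝓝 (z : ℂ) :=
  isOpenEmbedding_coe.map_nhds_eq z

lemma map_hauptmodul_nhds (z : ℍ) :
    map (fun w : ℍ => hauptmodul w) (𝓝 z) = 𝓝 (hauptmodul z) := by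
  rw [← (hasStrictDerivAt_hauptmodul z.im_pos).map_nhds_eq (deriv_hauptmodul_ne_zero z),
    ← map_nhds_coe, map_map]
  rfl

lemma exists_injOn_hauptmodul (z : ℍ) : ∃ U ∈ 𝓝 z, Set.InjOn (fun w : ℍ => hauptmodul w) U := by
  have h := ((hasStrictDerivAt_hauptmodul z.im_pos).hasStrictFDerivAt_equiv
    (deriv_hauptmodul_ne_zero z)).eventually_left_inverse
  refine ⟨_, continuous_coe.continuousAt.eventually h, fun u hu w hw huw => ?_⟩
  simp only [Set.mem_ofPred_eq] at hu hw huw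
  ext1
  rw [← hu, ← hw, huw]

/-- Equivalence of points of the upper half plane modulo `Γ(4)`. -/
def GammaFourEquiv (z w : ℍ) : Prop := ∃ γ ∈ Γ(4), γ • z = w

lemma GammaFourEquiv.symm {z w : ℍ} (h : GammaFourEquiv z w) : GammaFourEquiv w z := by
  obtain ⟨γ, hγ, rfl⟩ := h
  exact ⟨γ⁻¹, inv_mem hγ, inv_smul_smul _ _⟩

lemma GammaFourEquiv.trans {z w v : ℍ} (h : GammaFourEquiv z w) (h' : GammaFourEquiv w v) :
    GammaFourEquiv z v := by
  obtain ⟨γ, hγ, rfl⟩ := h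
  obtain ⟨δ, hδ, rfl⟩ := h'
  exact ⟨δ * γ, mul_mem hδ hγ, mul_smul _ _ _⟩

/-- The quotient by Γ(4) is Hausdorff, and this is the preimage of its diagonal. -/
lemma isClosed_gammaFourEquiv : IsClosed {x : ℍ × ℍ | GammaFourEquiv x.1 x.2} := by
  let q : ℍ → MulAction.orbitRel.Quotient (Γ(4).map (mapGL ℝ)) ℍ := Quotient.mk _
  have hq : Continuous q := continuous_quot_mk
  have h : {x : ℍ × ℍ | GammaFourEquiv x.1 x.2} = {x | q x.2 = q x.1} := by
    ext ⟨z, w⟩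
    simp only [Set.mem_ofPred_eq]
    refine Iff.trans ?_ Quotient.eq.symm
    constructor
    · rintro ⟨γ, hγ, h⟩
      exact ⟨⟨mapGL ℝ γ, γ, hγ, rfl⟩, h⟩
    · rintro ⟨⟨_, γ, hγ, rfl⟩, h⟩
      exact ⟨γ, hγ, h⟩
  rw [h]
  exact isClosed_eq (hq.comp continuous_snd) (hq.comp continuous_fst)

/-- Near a pair (z, γz), local injectivity of r forces pairs with equal values to be related by the
same γ. So inequivalent pairs cannot converge to an equivalent one. -/
lemma isClosed_hauptmodul_eq_not_gammaFourEquiv : IsClosed {x : ℍ × ℍ |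
    hauptmodul x.1 = hauptmodul x.2 ∧ ¬ GammaFourEquiv x.1 x.2} := by
  rw [← isOpen_compl_iff, isOpen_iff_mem_nhds]
  rintro ⟨z, w⟩ hzw
  simp only [Set.mem_compl_iff, Set.mem_ofPred_eq, not_and, not_not] at hzw
  have hc := continuous_hauptmodul
  by_cases h : hauptmodul z = hauptmodul w
  · obtain ⟨γ, hγ, rfl⟩ := hzw h
    obtain ⟨U, hU, hinj⟩ := exists_injOn_hauptmodul (γ • z)
    have h1 : ∀ᶠ x : ℍ × ℍ in 𝓝 (z, γ • z), γ • x.1 ∈ U :=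
      ((continuous_SL_smul γ).comp continuous_fst).continuousAt.eventually hU
    have h2 : ∀ᶠ x : ℍ × ℍ in 𝓝 (z, γ • z), x.2 ∈ U :=
      (continuous_snd (X := ℍ) (Y := ℍ)).continuousAt.eventually hU
    filter_upwards [h1, h2] with x hx1 hx2
    rintro ⟨hx, hx'⟩
    refine hx' ⟨γ, hγ, hinj hx1 hx2 ?_⟩
    simp only [hauptmodul_smul_of_mem hγ, hx]
  · have : ∀ᶠ x : ℍ × ℍ in 𝓝 (z, w), hauptmodul x.1 ≠ hauptmodul x.2 :=
      (isOpen_ne_fun (hc.comp continuous_fst) (hc.comp continuous_snd)).mem_nhds h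
    filter_upwards [this] with x hx using fun hx' => hx hx'.1

/-- The set of values of the Hauptmodul that are taken at inequivalent points. -/
def multipleValues : Set ℂ := {v | ∃ z w : ℍ, hauptmodul z = v ∧ hauptmodul w = v ∧
  ¬ GammaFourEquiv z w}

/-- Inequivalence is an open condition on pairs, and r is an open map. -/
lemma isOpen_multipleValues : IsOpen multipleValues := by
  rw [isOpen_iff_mem_nhds]
  rintro _ ⟨z, w, rfl, hw, h⟩
  have hU := isClosed_gammaFourEquiv.isOpen_compl.mem_nhds (show (z, w) ∈ _ from h)
  rw [nhds_prod_eq, mem_prod_iff] at hU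
  obtain ⟨U, hU, U', hU', hUU'⟩ := hU
  have h1 : (fun w : ℍ => hauptmodul w) '' U ∈ 𝓝 (hauptmodul z) := by
    rw [← map_hauptmodul_nhds]
    exact image_mem_map hU
  have h2 : (fun w : ℍ => hauptmodul w) '' U' ∈ 𝓝 (hauptmodul z) := by
    rw [← hw, ← map_hauptmodul_nhds]
    exact image_mem_map hU'
  filter_upwards [h1, h2]
  rintro v ⟨x, hx, hxv⟩ ⟨y, hy, hyv⟩
  exact ⟨x, y, hxv, hyv, hUU' (Set.mk_mem_prod hx hy)⟩

/-- Near v the values have `height` above half that of v, so both preimages can be moved into a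
fixed compact set. There the inequivalent pairs with equal values form a compact set, whose image
under r is closed. -/
lemma closure_multipleValues_inter_subset :
    closure multipleValues ∩ {v | v * (1 - v ^ 4) ≠ 0} ⊆ multipleValues := by
  rintro v ⟨hv, hv0⟩
  have hc := height_pos hv0
  obtain ⟨K, hK, hK'⟩ := exists_isCompact_of_le_height (half_pos hc)
  have hcomp : IsCompact ((K ×ˢ K) ∩ {x : ℍ × ℍ |
      hauptmodul x.1 = hauptmodul x.2 ∧ ¬ GammaFourEquiv x.1 x.2}) :=
    (hK.prod hK).inter_right isClosed_hauptmodul_eq_not_gammaFourEquiv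
  have hcl := (hcomp.image (continuous_hauptmodul.comp continuous_fst)).isClosed
  set D := (fun z : ℍ => hauptmodul z) ∘ Prod.fst '' ((K ×ˢ K) ∩ {x : ℍ × ℍ |
      hauptmodul x.1 = hauptmodul x.2 ∧ ¬ GammaFourEquiv x.1 x.2}) with hD
  have hDsub : D ⊆ multipleValues := by
    rintro _ ⟨⟨z, w⟩, ⟨-, h, h'⟩, rfl⟩
    exact ⟨z, w, rfl, h.symm, h'⟩
  have hnhds : {u | height v / 2 < height u} ∈ 𝓝 v :=
    continuous_height.continuousAt.eventually (lt_mem_nhds (half_lt_self hc))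
  refine hDsub (hcl.closure_subset (mem_closure_iff_nhds.mpr fun t ht => ?_))
  obtain ⟨u, ⟨hut, hu⟩, z, w, rfl, hw, h⟩ :=
    mem_closure_iff_nhds.mp hv _ (inter_mem ht hnhds)
  obtain ⟨γ, hγ, hγz⟩ := hK' z (le_of_lt hu)
  obtain ⟨δ, hδ, hδw⟩ := hK' w (by rw [hw]; exact le_of_lt hu)
  refine ⟨_, hut, (γ • z, δ • w), ⟨⟨hγz, hδw⟩, ?_, fun h' => h ?_⟩, ?_⟩
  · simp only [hauptmodul_smul_of_mem hγ, hauptmodul_smul_of_mem hδ, hw]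
  · exact (GammaFourEquiv.trans ⟨γ, hγ, rfl⟩ h').trans (GammaFourEquiv.symm ⟨δ, hδ, rfl⟩)
  · simp only [Function.comp_apply, hauptmodul_smul_of_mem hγ]

/-- The Hauptmodul separates the points of the upper half plane modulo `Γ(4)`. -/
theorem exists_smul_eq_of_hauptmodul_eq {z w : ℍ} (h : hauptmodul z = hauptmodul w) :
    ∃ γ ∈ Γ(4), γ • z = w := by
  by_contra hcon
  have hfin : {v : ℂ | v * (1 - v ^ 4) ≠ 0}ᶜ.Finite := by
    let P : Polynomial ℂ := Polynomial.X * (1 - Polynomial.X ^ 4)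
    have hP : P ≠ 0 := fun hP => by
      have := congrArg (Polynomial.eval 2) hP
      norm_num [P] at this
    refine P.roots.toFinset.finite_toSet.subset fun v hv => ?_
    have hv : v * (1 - v ^ 4) = 0 := not_not.mp hv
    simp [hP, P, hv]
  have hconn : IsPreconnected {v : ℂ | v * (1 - v ^ 4) ≠ 0} := by
    rw [← compl_compl {v : ℂ | v * (1 - v ^ 4) ≠ 0}]
    exact (hfin.countable.isPathConnected_compl_of_one_lt_rank
      (by rw [Complex.rank_real_complex]; norm_num)).isConnected.isPreconnected
  -- A single multiple value would make every value outside the five exceptions multiple, including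
  -- the small values taken near infinity, which are taken on one orbit only.
  have hsub := hconn.subset_of_closure_inter_subset isOpen_multipleValues
    ⟨hauptmodul z, hauptmodul_mul_ne_zero z, z, w, rfl, h.symm, hcon⟩
    closure_multipleValues_inter_subset
  obtain ⟨ε, hε, hinj⟩ := exists_hauptmodul_inj_of_norm_lt
  obtain ⟨Y, hY⟩ := (atImInfty_mem _).mp
    (tendsto_hauptmodul.norm (Iio_mem_nhds (by simpa using hε : ‖(0 : ℂ)‖ < ε)))
  obtain ⟨x, hx⟩ : ∃ x : ℍ, Y ≤ x.im :=
    ⟨⟨⟨0, max Y 1⟩, by simp⟩, le_max_left Y 1⟩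
  obtain ⟨u, v, hu, hv, huv⟩ := hsub (hauptmodul_mul_ne_zero x)
  exact huv (hinj u v (by rw [hu]; exact hY x hx) (hu.trans hv.symm))

/-! ### The homogeneous coordinates of `F` -/

lemma coe_SL_smul (γ : SL(2, ℤ)) (z : ℍ) : ((γ • z : ℍ) : ℂ) =
    ((γ 0 0 : ℂ) * z + (γ 0 1 : ℂ)) / ((γ 1 0 : ℂ) * z + (γ 1 1 : ℂ)) := by
  rw [coe_specialLinearGroup_apply]
  simp

lemma SL_denom_ne_zero (γ : SL(2, ℤ)) (z : ℍ) : (γ 1 0 : ℂ) * z + (γ 1 1 : ℂ) ≠ 0 := by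
  rw [← denom_apply]
  exact denom_ne_zero _ z

lemma int_linear_inj (z : ℍ) {x y x' y' : ℤ} (h : (x : ℂ) * z + y = (x' : ℂ) * z + y') :
    x = x' ∧ y = y' := by
  have him := congrArg Complex.im h
  simp only [Complex.add_im, Complex.mul_im, Complex.intCast_re, Complex.intCast_im, zero_mul,
    add_zero] at him
  have hx : x = x' := by exact_mod_cast mul_right_cancel₀ z.im_ne_zero him
  refine ⟨hx, ?_⟩
  rw [hx, add_right_inj] at h
  exact_mod_cast h

/-- The point `(z + n) / p` of the upper half plane. -/
noncomputable def divShift (p : ℕ) (hp : 0 < p) (n : ℤ) (z : ℍ) : ℍ :=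
  ⟨((z : ℂ) + n) / p, by
    have : (0 : ℝ) < p := by exact_mod_cast hp
    rw [Complex.div_natCast_im]
    simpa using div_pos z.im_pos this⟩

lemma coe_divShift {p : ℕ} (hp : 0 < p) (n : ℤ) (z : ℍ) :
    (divShift p hp n z : ℂ) = ((z : ℂ) + n) / p := rfl

lemma coords_none (p : ℕ) (z : ℍ) (i : Fin 3) : coords p z (i, none) = baseFun i z := by
  simp [coords, slashOne, matS, baseFun]

lemma coords_some {p : ℕ} (hp : 0 < p) (z : ℍ) (i : Fin 3) (b : Fin p) :
    coords p z (i, some b) = baseFun i (divShift p hp b z) * (p : ℂ)⁻¹ := by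
  simp [coords, slashOne, matS, baseFun, coe_divShift]

lemma det_matS (p : ℕ) (s : Option (Fin p)) : (matS p s).det = 1 ∨ (matS p s).det = p := by
  cases s with
  | none => exact Or.inl (by simp [matS])
  | some b => exact Or.inr (by simp [matS, Matrix.det_fin_two])

lemma coords_mem_V (p : ℕ) (i : Idx p) : (fun z => coords p z i) ∈ V p :=
  Submodule.subset_span ⟨i.1, matS p i.2, det_matS p i.2, rfl⟩

lemma baseFun_zero_ne_zero (z : ℍ) : baseFun 0 z ≠ 0 := pow_ne_zero 2 (theta_ne_zero z)

lemma baseFun_one_eq (z : ℍ) : baseFun 1 z = 2 * hauptmodul z * baseFun 0 z := by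
  have := baseFun_zero_ne_zero z
  rw [hauptmodul_eq_div]
  field_simp

lemma coords_zero_none_ne_zero (p : ℕ) (z : ℍ) : coords p z (0, none) ≠ 0 := by
  rw [coords_none]
  exact baseFun_zero_ne_zero z

lemma coords_ne_zero (p : ℕ) (z : ℍ) : coords p z ≠ 0 := fun h =>
  coords_zero_none_ne_zero p z (congrFun h _)

lemma apply_smul_of_mem_V {p : ℕ} (hp : p.Prime) (hodd : Odd p) {g : ℍ → ℂ} (hg : g ∈ V p)
    {β : SL(2, ℤ)} (hβ : β ∈ GammaPM p) (z : ℍ) :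
    g (β • z) = g z * (β 1 0 * z + β 1 1) := by
  obtain ⟨G, rfl⟩ := exists_modularForm_of_mem_V hp hodd hg
  have h : (⇑G ∣[(1 : ℤ)] β) = ⇑G :=
    SlashInvariantFormClass.slash_action_eq G (mapGL ℝ β) ⟨β, hβ, rfl⟩
  have h := congrFun h z
  have hd : denom β z ≠ 0 := denom_ne_zero _ z
  rw [SL_slash_apply, zpow_neg_one] at h
  rw [← denom_apply, ← h, inv_mul_cancel_right₀ hd]

lemma mdifferentiable_of_mem_V {p : ℕ} (hp : p.Prime) (hodd : Odd p) {g : ℍ → ℂ} (hg : g ∈ V p) :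
    MDiff g := by
  obtain ⟨G, rfl⟩ := exists_modularForm_of_mem_V hp hodd hg
  exact ModularFormClass.holo G

lemma coords_smul {p : ℕ} (hp : p.Prime) (hodd : Odd p) {β : SL(2, ℤ)} (hβ : β ∈ GammaPM p)
    (z : ℍ) : coords p (β • z) = (β 1 0 * z + β 1 1 : ℂ) • coords p z := by
  ext i
  rw [Pi.smul_apply, smul_eq_mul, mul_comm]
  exact apply_smul_of_mem_V hp hodd (coords_mem_V p i) hβ z

/-- If the points `z`, `γ z` and also their images `(z + n) / p`, `(γ z + n) / p` are related by
elements of `Γ(4)` with the same factor of automorphy, then `p` divides a polynomial in the entries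
of `γ`. -/
lemma dvd_of_divShift_smul {p : ℕ} (hp : 0 < p) (n : ℤ) {γ δ : SL(2, ℤ)} {z : ℍ}
    (h : divShift p hp n (γ • z) = δ • divShift p hp n z)
    (hd : (γ 1 0 : ℂ) * z + (γ 1 1 : ℂ) = (δ 1 0 : ℂ) * divShift p hp n z + (δ 1 1 : ℂ)) :
    (p : ℤ) ∣ γ 0 1 + n * (γ 1 1 - γ 0 0) - n ^ 2 * γ 1 0 := by
  have hp' : (p : ℂ) ≠ 0 := by exact_mod_cast hp.ne'
  have h := congrArg ((↑) : ℍ → ℂ) h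
  rw [coe_divShift, coe_SL_smul, coe_SL_smul, ← hd, coe_divShift] at h
  have hj := SL_denom_ne_zero γ z
  -- Equal factors of automorphy cancel the denominators, leaving an identity between integral
  -- linear functions of z, whose coefficients must agree.
  have e2 : ((γ 0 0 + n * γ 1 0 : ℤ) : ℂ) * z + ((γ 0 1 + n * γ 1 1 : ℤ) : ℂ) =
      ((δ 0 0 : ℤ) : ℂ) * z + ((δ 0 0 * n + p * δ 0 1 : ℤ) : ℂ) := by
    push_cast
    generalize hJ : (γ 1 0 : ℂ) * z + (γ 1 1 : ℂ) = J at h hj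
    field_simp at h
    linear_combination h + n * hJ
  obtain ⟨h3, h4⟩ := int_linear_inj z e2
  refine ⟨δ 0 1, ?_⟩
  rw [← h3] at h4
  linear_combination h4

/-- A polynomial of degree 2 in n that vanishes mod p at 0, 1, 2 is zero, as p is odd. So γ is
scalar mod p, and its determinant makes the scalar ±1. -/
lemma mem_GammaPM_of_dvd {p : ℕ} (hp : p.Prime) (hodd : Odd p) {γ : SL(2, ℤ)} (hγ : γ ∈ Γ(4))
    (h : ∀ n : ℤ, 0 ≤ n → n < p → (p : ℤ) ∣ γ 0 1 + n * (γ 1 1 - γ 0 0) - n ^ 2 * γ 1 0) :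
    γ ∈ GammaPM p := by
  have : Fact p.Prime := ⟨hp⟩
  have h3 : (3 : ℤ) ≤ p := by
    have h2 := hp.two_le
    obtain ⟨k, hk⟩ := hodd
    omega
  have hb : (p : ℤ) ∣ γ 0 1 := by simpa using h 0 le_rfl (by omega)
  have h1 := h 1 (by norm_num) (by omega)
  have h2 := h 2 (by norm_num) (by omega)
  have hc : (p : ℤ) ∣ 2 * γ 1 0 := by
    have := (((dvd_mul_right (p : ℤ) 2).mul_right 0).add ((h1.mul_left 2).sub h2)).sub hb
    ring_nf at this ⊢
    exact this
  have hcop : IsCoprime (p : ℤ) 2 := by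
    rw [Int.isCoprime_iff_gcd_eq_one]
    exact_mod_cast (Nat.coprime_two_right.mpr hodd)
  have hc : (p : ℤ) ∣ γ 1 0 := hcop.dvd_of_dvd_mul_left hc
  have hda : (p : ℤ) ∣ γ 1 1 - γ 0 0 := by
    have := (h1.sub hb).add hc
    ring_nf at this ⊢
    exact this
  have hdet := γ.det_coe
  rw [Matrix.det_fin_two] at hdet
  refine ⟨hγ, ?_⟩
  have cb : ((γ 0 1 : ℤ) : ZMod p) = 0 := (ZMod.intCast_zmod_eq_zero_iff_dvd _ _).mpr hb
  have cc : ((γ 1 0 : ℤ) : ZMod p) = 0 := (ZMod.intCast_zmod_eq_zero_iff_dvd _ _).mpr hc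
  have cd : ((γ 1 1 : ℤ) : ZMod p) = ((γ 0 0 : ℤ) : ZMod p) := by
    have := (ZMod.intCast_zmod_eq_zero_iff_dvd _ p).mpr hda
    rwa [Int.cast_sub, sub_eq_zero] at this
  have hsq : ((γ 0 0 : ℤ) : ZMod p) * ((γ 0 0 : ℤ) : ZMod p) = 1 := by
    have := congrArg (Int.cast : ℤ → ZMod p) hdet
    push_cast at this
    rwa [cb, cc, cd, mul_zero, sub_zero] at this
  rcases mul_self_eq_one_iff.mp hsq with ha | ha
  · left
    ext i j
    fin_cases i <;> fin_cases j <;> simp [cb, cc, cd, ha]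
  · right
    ext i j
    fin_cases i <;> fin_cases j <;> simp [cb, cc, cd, ha]

/-- Ratios of coordinates only yield separate Γ(4)-equivalences, one for each matrix in S. It is the
common scalar μ, equal to every factor of automorphy involved, that ties them together. -/
lemma exists_smul_eq_of_coords_eq {p : ℕ} (hp : p.Prime) (hodd : Odd p) {z w : ℍ} {μ : ℂ}
    (h : ∀ i, coords p w i = μ * coords p z i) : ∃ β ∈ GammaPM p, β • z = w := by
  have key : ∀ z' w' : ℍ, (∀ i, baseFun i w' = μ * baseFun i z') →
      hauptmodul z' = hauptmodul w' := by
    intro z' w' h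
    have hμ : μ ≠ 0 := fun h0 => baseFun_zero_ne_zero w' (by rw [h, h0, zero_mul])
    rw [hauptmodul_eq_div, hauptmodul_eq_div, h 0, h 1, mul_left_comm, mul_div_mul_left _ _ hμ]
  have hfac : ∀ {γ : SL(2, ℤ)} {z' w' : ℍ}, (∀ i, baseFun i w' = μ * baseFun i z') → γ ∈ Γ(4) →
      γ • z' = w' → (γ 1 0 : ℂ) * z' + γ 1 1 = μ := by
    rintro γ z' _ h hγ rfl
    have h0 := h 0
    rw [baseFun_smul_of_mem hγ, mul_comm] at h0
    exact mul_right_cancel₀ (baseFun_zero_ne_zero z') h0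
  have h0 : ∀ i, baseFun i w = μ * baseFun i z := fun i => by
    simpa only [coords_none] using h (i, none)
  have hb : ∀ (b : Fin p) (i : Fin 3), baseFun i (divShift p hp.pos b w) =
      μ * baseFun i (divShift p hp.pos b z) := fun b i => by
    have hp' : (p : ℂ)⁻¹ ≠ 0 := inv_ne_zero (by exact_mod_cast hp.ne_zero)
    have := h (i, some b)
    rw [coords_some hp.pos, coords_some hp.pos, ← mul_assoc] at this
    exact mul_right_cancel₀ hp' this
  obtain ⟨γ, hγ, rfl⟩ := exists_smul_eq_of_hauptmodul_eq (key z w h0)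
  refine ⟨γ, mem_GammaPM_of_dvd hp hodd hγ fun n hn hnp => ?_, rfl⟩
  lift n to ℕ using hn
  have hnp : n < p := by exact_mod_cast hnp
  obtain ⟨δ, hδ, hδw⟩ := exists_smul_eq_of_hauptmodul_eq (key _ _ (hb ⟨n, hnp⟩))
  exact dvd_of_divShift_smul hp.pos n hδw.symm
    ((hfac h0 hγ rfl).trans (hfac (hb ⟨n, hnp⟩) hδ hδw).symm)

/-! ### Injectivity on the quotient and separation of points. -/

lemma toOpenCurve_eq_iff {p : ℕ} {z w : ℍ} :
    toOpenCurve p z = toOpenCurve p w ↔ ∃ β ∈ GammaPM p, β • z = w := by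
  refine Iff.trans (eq_comm.trans Quotient.eq) ?_
  constructor
  · rintro ⟨⟨_, β, hβ, rfl⟩, h⟩
    exact ⟨β, hβ, h⟩
  · rintro ⟨β, hβ, h⟩
    exact ⟨⟨mapGL ℝ β, β, hβ, rfl⟩, h⟩

lemma F_eq_iff {p : ℕ} (hp : p.Prime) (hodd : Odd p) (hF : ∀ z, coords p z ≠ 0) {z w : ℍ} :
    F p hF z = F p hF w ↔ toOpenCurve p z = toOpenCurve p w := by
  rw [toOpenCurve_eq_iff, eq_comm, F, F, Projectivization.mk_eq_mk_iff']
  constructor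
  · rintro ⟨μ, hμ⟩
    exact exists_smul_eq_of_coords_eq hp hodd (μ := μ) fun i => (congrFun hμ i).symm
  · rintro ⟨β, hβ, rfl⟩
    exact ⟨_, (coords_smul hp hodd hβ z).symm⟩

/-- The quotients of the homogeneous coordinates of `F` by the first of them. -/
noncomputable def affineCoords (p : ℕ) (z : ℍ) (i : Idx p) : ℂ :=
  coords p z i / coords p z (0, none)

lemma affineCoords_eq_iff {p : ℕ} (hp : p.Prime) (hodd : Odd p) {z w : ℍ} :
    affineCoords p z = affineCoords p w ↔ toOpenCurve p z = toOpenCurve p w := by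
  have hz := coords_zero_none_ne_zero p z
  have hw := coords_zero_none_ne_zero p w
  rw [toOpenCurve_eq_iff]
  constructor
  · intro h
    refine exists_smul_eq_of_coords_eq hp hodd
      (μ := coords p w (0, none) / coords p z (0, none)) fun i => ?_
    have := congrFun h i
    simp only [affineCoords] at this
    field_simp at this ⊢
    linear_combination -this
  · rintro ⟨β, hβ, rfl⟩
    ext i
    simp only [affineCoords, coords_smul hp hodd hβ, Pi.smul_apply, smul_eq_mul]
    rw [mul_div_mul_left _ _ (SL_denom_ne_zero β z)]

/-- The elements of `V` separate the noncuspidal points. -/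
lemma exists_mem_V_separating {p : ℕ} (hp : p.Prime) (hodd : Odd p) {z w : ℍ}
    (h : toOpenCurve p z ≠ toOpenCurve p w) : ∃ g ∈ V p, g z = 0 ∧ g w ≠ 0 := by
  have hne : affineCoords p z ≠ affineCoords p w := fun h' =>
    h ((affineCoords_eq_iff hp hodd).mp h')
  obtain ⟨i, hi⟩ := Function.ne_iff.mp hne
  refine ⟨coords p z (0, none) • (fun z => coords p z i) -
    coords p z i • (fun z => coords p z (0, none)),
    Submodule.sub_mem _ (Submodule.smul_mem _ _ (coords_mem_V p i))
      (Submodule.smul_mem _ _ (coords_mem_V p _)), ?_, fun h0 => hi ?_⟩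
  · simp [mul_comm]
  · simp only [Pi.sub_apply, Pi.smul_apply, smul_eq_mul] at h0
    rw [affineCoords, affineCoords, div_eq_div_iff (coords_zero_none_ne_zero p z)
      (coords_zero_none_ne_zero p w)]
    linear_combination -h0

/-! ### Orders of vanishing at the noncuspidal points -/

/-- Every noncuspidal point is a simple zero of an element of `V`. -/
lemma exists_mem_V_vanishesToOrder_inl (p : ℕ) (y : OpenCurve p) :
    ∃ g ∈ V p, VanishesToOrder p g 1 (Sum.inl y) := by
  obtain ⟨z₀, rfl⟩ : ∃ z₀, toOpenCurve p z₀ = y := Quotient.exists_rep y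
  set r₀ := hauptmodul z₀ with hr₀
  -- This is 2r₀M - N = 2θ²(r₀ - r), with a simple zero wherever r = r₀, since neither θ nor r'
  -- vanishes.
  refine ⟨(2 * r₀) • (fun z => coords p z (0, none)) - (fun z => coords p z (1, none)),
    Submodule.sub_mem _ (Submodule.smul_mem _ _ (coords_mem_V p _)) (coords_mem_V p _), ?_⟩
  intro z hz
  obtain ⟨β, hβ, rfl⟩ := toOpenCurve_eq_iff.mp hz
  have hr : hauptmodul z = r₀ := (hauptmodul_smul_of_mem hβ.1 z).symm
  have hev : (((2 * r₀) • (fun z => coords p z (0, none)) - (fun z => coords p z (1, none))) ∘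
      ofComplex) =ᶠ[𝓝 (z : ℂ)] fun u => 2 * theta u ^ 2 * (r₀ - hauptmodul u) := by
    filter_upwards [isOpen_upperHalfPlaneSet.mem_nhds z.im_pos] with u hu
    have h0 : theta u ≠ 0 := theta_ne_zero ⟨u, hu⟩
    simp only [Function.comp_apply, Pi.sub_apply, Pi.smul_apply, smul_eq_mul, coords_none,
      ofComplex_apply_of_im_pos hu, baseFun, baseForm, hauptmodul, Matrix.cons_val]
    field_simp
  have hdiff : DifferentiableOn ℂ (fun u => 2 * theta u ^ 2 * (r₀ - hauptmodul u))
      upperHalfPlaneSet := fun u hu =>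
    ((((differentiableAt_theta hu).pow 2).const_mul 2).mul
      ((differentiableAt_const _).sub (differentiableAt_hauptmodul hu))).differentiableWithinAt
  rw [analyticOrderAt_congr hev]
  have hd : HasDerivAt (fun u => 2 * theta u ^ 2 * (r₀ - hauptmodul u))
      (-(2 * theta z ^ 2 * deriv hauptmodul z)) z := by
    have h1 := (((differentiableAt_theta z.im_pos).pow 2).const_mul 2).hasDerivAt
    have h2 := (differentiableAt_hauptmodul z.im_pos).hasDerivAt.const_sub r₀
    refine (h1.mul h2).congr_deriv ?_
    rw [hr, sub_self, mul_zero, zero_add, mul_neg, Pi.pow_apply]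
  refine (hdiff.analyticAt (isOpen_upperHalfPlaneSet.mem_nhds
    z.im_pos)).analyticOrderAt_eq_one_of_zero_deriv_ne_zero (by simp [hr]) ?_
  rw [hd.deriv]
  exact neg_ne_zero.mpr (mul_ne_zero (mul_ne_zero two_ne_zero (pow_ne_zero 2 (theta_ne_zero z)))
    (deriv_hauptmodul_ne_zero z))

/-- The map `F` is a holomorphic immersion. -/
lemma isHolomorphicImmersion_coords {p : ℕ} (hp : p.Prime) (hodd : Odd p) :
    IsHolomorphicImmersion (coords p) := by
  refine ⟨fun i => mdifferentiable_of_mem_V hp hodd (coords_mem_V p i), fun z =>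
    -- In the chart M ≠ 0 the coordinate N/M is 2r.
    ⟨(0, none), (1, none), coords_zero_none_ne_zero p z, ?_⟩⟩
  have hev : (fun w : ℂ => coords p (ofComplex w) (1, none) / coords p (ofComplex w) (0, none))
      =ᶠ[𝓝 (z : ℂ)] fun u => 2 * hauptmodul u := by
    filter_upwards [isOpen_upperHalfPlaneSet.mem_nhds z.im_pos] with u hu
    rw [coords_none, coords_none, baseFun_one_eq, mul_div_cancel_right₀ _ (baseFun_zero_ne_zero _),
      ofComplex_apply_of_im_pos hu]
  rw [hev.deriv_eq, deriv_const_mul _ (differentiableAt_hauptmodul z.im_pos)]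
  exact mul_ne_zero two_ne_zero (deriv_hauptmodul_ne_zero z)

/-! ### The embedding of the noncuspidal points -/

lemma continuous_coords (p : ℕ) (hp : p.Prime) (hodd : Odd p) : Continuous (coords p) :=
  continuous_pi fun i => (mdifferentiable_of_mem_V hp hodd (coords_mem_V p i)).continuous

lemma continuous_affineCoords (p : ℕ) (hp : p.Prime) (hodd : Odd p) :
    Continuous (affineCoords p) :=
  continuous_pi fun i => Continuous.div
    ((_root_.continuous_apply i).comp (continuous_coords p hp hodd))
    ((_root_.continuous_apply _).comp (continuous_coords p hp hodd)) (coords_zero_none_ne_zero p)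

lemma continuous_toOpenCurve (p : ℕ) : Continuous (toOpenCurve p) := continuous_quot_mk

lemma finiteIndex_GammaPM {p : ℕ} (hp : p.Prime) : (GammaPM p).FiniteIndex := by
  have : NeZero p := ⟨hp.ne_zero⟩
  exact Subgroup.finiteIndex_of_le (H := Γ(4) ⊓ Γ(p)) fun γ hγ => ⟨hγ.1, Or.inl hγ.2⟩

lemma affineCoords_one_none (p : ℕ) (z : ℍ) :
    affineCoords p z (1, none) = 2 * hauptmodul z := by
  rw [affineCoords, coords_none, coords_none, baseFun_one_eq,
    mul_div_cancel_right₀ _ (baseFun_zero_ne_zero z)]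

/-- Points with nearby affine coordinates are close to each other on the quotient. -/
lemma eventually_mem_of_affineCoords {p : ℕ} (hp : p.Prime) (hodd : Odd p) (w : ℍ)
    {W : Set (OpenCurve p)} (hW : W ∈ 𝓝 (toOpenCurve p w)) :
    ∀ᶠ a in 𝓝 (affineCoords p w), ∀ z, affineCoords p z = a → toOpenCurve p z ∈ W := by
  have hfin := finiteIndex_GammaPM hp
  have hcont := continuous_affineCoords p hp hodd
  -- Either tw represents the same point as w, and continuity suffices, or the coordinates of tw
  -- differ from those of w and can be kept away from them.
  have key : ∀ t : SL(2, ℤ), ∃ O ∈ 𝓝 (affineCoords p w), ∃ N ∈ 𝓝 w,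
      ∀ z ∈ N, affineCoords p (t • z) ∈ O → toOpenCurve p (t • z) ∈ W := by
    intro t
    by_cases ht : toOpenCurve p (t • w) = toOpenCurve p w
    · rw [← ht] at hW
      exact ⟨Set.univ, univ_mem, _, ((continuous_toOpenCurve p).comp
        (continuous_SL_smul t)).continuousAt.preimage_mem_nhds hW, fun z hz _ => hz⟩
    · have hne : affineCoords p w ≠ affineCoords p (t • w) := fun h =>
        ht ((affineCoords_eq_iff hp hodd).mp h).symm
      obtain ⟨O, O', hO, hO', hw, htw, hdisj⟩ := t2_separation hne
      refine ⟨O, hO.mem_nhds hw, _,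
        (hcont.comp (continuous_SL_smul t)).continuousAt.preimage_mem_nhds (hO'.mem_nhds htw),
        fun z hz hz' => ?_⟩
      exact absurd hz (Set.disjoint_left.mp hdisj hz')
  choose O hO N hN h using key
  let t : SL(2, ℤ) ⧸ GammaPM p → SL(2, ℤ) := fun q => q.out⁻¹
  have hN' : ⋂ q, N (t q) ∈ 𝓝 w := iInter_mem.mpr fun q => hN _
  have hO' : ∀ᶠ a in 𝓝 (affineCoords p w), ∀ q, a ∈ O (t q) := eventually_all.mpr fun q => hO _
  have himg : ∀ᶠ a in 𝓝 (affineCoords p w),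
      a (1, none) / 2 ∈ (fun z : ℍ => hauptmodul z) '' ⋂ q, N (t q) := by
    have hc : ContinuousAt (fun a : Idx p → ℂ => a (1, none) / 2) (affineCoords p w) :=
      ((_root_.continuous_apply _).div_const 2).continuousAt
    refine hc.eventually_mem ?_
    rw [affineCoords_one_none, mul_div_cancel_left₀ _ two_ne_zero, ← map_hauptmodul_nhds]
    exact image_mem_map hN'
  filter_upwards [hO', himg]
  rintro _ hO ⟨v, hv, hvr⟩ z rfl
  rw [affineCoords_one_none, mul_div_cancel_left₀ _ two_ne_zero] at hvr
  -- Since r is open, r(z) is also taken at some v near w, so z = γv. Modulo Γ_±(4p), γ may be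
  -- replaced by one of the finitely many representatives handled by `key`.
  obtain ⟨γ, hγ, rfl⟩ := exists_smul_eq_of_hauptmodul_eq hvr
  obtain ⟨β, hβ⟩ := QuotientGroup.mk_out_eq_mul (GammaPM p) γ⁻¹
  set q : SL(2, ℤ) ⧸ GammaPM p := QuotientGroup.mk γ⁻¹ with hq
  have heq : toOpenCurve p (γ • v) = toOpenCurve p (t q • v) := by
    refine toOpenCurve_eq_iff.mpr ⟨(β : SL(2, ℤ))⁻¹, inv_mem β.2, ?_⟩
    simp only [t, hβ, mul_inv_rev, inv_inv, mul_smul]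
  rw [heq]
  refine h (t q) v (Set.mem_iInter.mp hv q) ?_
  rw [← (affineCoords_eq_iff hp hodd).mpr heq]
  exact hO q

/-- The affine coordinates of a point of projective space, with respect to the coordinate `i`. -/
noncomputable def projAffine {ι : Type} (i : ι) (x : ℙ ℂ (ι → ℂ)) (j : ι) : ℂ := x.rep j / x.rep i

lemma projAffine_mk {ι : Type} (i : ι) (v : ι → ℂ) (hv : v ≠ 0) (j : ι) :
    projAffine i (Projectivization.mk ℂ v hv) j = v j / v i := by
  obtain ⟨a, ha⟩ := Projectivization.exists_smul_eq_mk_rep ℂ v hv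
  rw [projAffine, ← ha]
  simp only [Pi.smul_apply, Units.smul_def, smul_eq_mul]
  rw [mul_div_mul_left _ _ a.ne_zero]

lemma continuousAt_projAffine {ι : Type} (i : ι) (v : ι → ℂ) (hv : v ≠ 0) (hvi : v i ≠ 0) :
    ContinuousAt (projAffine i) (Projectivization.mk ℂ v hv) := by
  have hopen : IsOpen {u : {u : ι → ℂ // u ≠ 0} | (u : ι → ℂ) i ≠ 0} :=
    isOpen_ne_fun ((_root_.continuous_apply i).comp continuous_subtype_val) continuous_const
  have hc : ContinuousOn (fun (u : {u : ι → ℂ // u ≠ 0}) (j : ι) => (u : ι → ℂ) j / (u : ι → ℂ) i)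
      {u | (u : ι → ℂ) i ≠ 0} := by
    exact continuousOn_pi.mpr fun j => ContinuousOn.div
      ((_root_.continuous_apply j).comp continuous_subtype_val).continuousOn
      ((_root_.continuous_apply i).comp continuous_subtype_val).continuousOn fun u hu => hu
  intro W hW
  obtain ⟨W', hW', hW'open, hvW'⟩ := mem_nhds_iff.mp hW
  have hmem : ∀ u : {u : ι → ℂ // u ≠ 0}, projAffine i (Projectivization.mk' ℂ u) =
      fun j => (u : ι → ℂ) j / (u : ι → ℂ) i := fun u => funext fun j => projAffine_mk i u.1 u.2 j
  refine mem_map.mpr (mem_nhds_iff.mpr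
    -- The first condition says x_i ≠ 0: the quotient x_i / x_i is 1, or 0 when x_i = 0.
    ⟨{x | projAffine i x i ≠ 0 ∧ projAffine i x ∈ W'}, fun x hx => hW' hx.2, ?_, ?_, hvW'⟩)
  · refine isOpen_coinduced.mpr ?_
    have := hc.isOpen_inter_preimage hopen hW'open
    convert this using 1
    ext u
    simp only [Set.mem_preimage, Set.mem_ofPred_eq, hmem, Set.mem_inter_iff, ne_eq]
    refine and_congr_left fun _ => ⟨fun h h' => h (by rw [h', div_zero]), fun h => div_ne_zero h h⟩
  · rw [projAffine_mk]
    exact div_ne_zero hvi hvi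

/-- The map on the noncuspidal points that is induced by `F`. -/
noncomputable def FQuot {p : ℕ} (hp : p.Prime) (hodd : Odd p) (hF : ∀ z, coords p z ≠ 0) :
    OpenCurve p → ℙ ℂ (Idx p → ℂ) :=
  Quotient.lift (F p hF) fun _ _ h => (F_eq_iff hp hodd hF).mpr (Quotient.sound h)

lemma FQuot_toOpenCurve {p : ℕ} (hp : p.Prime) (hodd : Odd p) (hF : ∀ z, coords p z ≠ 0) (z : ℍ) :
    FQuot hp hodd hF (toOpenCurve p z) = F p hF z := rfl

lemma injective_FQuot {p : ℕ} (hp : p.Prime) (hodd : Odd p) (hF : ∀ z, coords p z ≠ 0) :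
    Function.Injective (FQuot hp hodd hF) := by
  rintro ⟨z⟩ ⟨w⟩ h
  exact (F_eq_iff hp hodd hF).mp h

lemma continuous_F {p : ℕ} (hp : p.Prime) (hodd : Odd p) (hF : ∀ z, coords p z ≠ 0) :
    Continuous (F p hF) :=
  (continuous_coinduced_rng (f := Projectivization.mk' ℂ)).comp
    ((continuous_coords p hp hodd).subtype_mk hF)

lemma isEmbedding_FQuot {p : ℕ} (hp : p.Prime) (hodd : Odd p) (hF : ∀ z, coords p z ≠ 0) :
    Topology.IsEmbedding (FQuot hp hodd hF) := by
  refine ⟨Topology.isInducing_iff_nhds.mpr fun y => ?_, injective_FQuot hp hodd hF⟩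
  have hcont : Continuous (FQuot hp hodd hF) := (continuous_F hp hodd hF).quotient_lift _
  refine le_antisymm (map_le_iff_le_comap.mp hcont.continuousAt) fun W hW => ?_
  obtain ⟨w, rfl⟩ : ∃ w, toOpenCurve p w = y := Quotient.exists_rep y
  have hproj : ∀ z, projAffine (0, none) (F p hF z) = affineCoords p z := fun z =>
    funext fun j => projAffine_mk _ _ _ j
  have hev := eventually_mem_of_affineCoords hp hodd w hW
  have hc := continuousAt_projAffine (0, none) (coords p w) (hF w) (coords_zero_none_ne_zero p w)
  rw [← hproj w] at hev
  refine mem_comap.mpr ⟨_, hc.eventually hev, fun y hy => ?_⟩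
  obtain ⟨z, rfl⟩ : ∃ z, toOpenCurve p z = y := Quotient.exists_rep y
  exact hy z (hproj z).symm

/-! ### The widths of the cusps -/

lemma conj_mem_GammaPM {p : ℕ} {β : SL(2, ℤ)} (hβ : β ∈ GammaPM p) (γ : SL(2, ℤ)) :
    γ * β * γ⁻¹ ∈ GammaPM p := by
  refine ⟨(Gamma_normal 4).conj_mem β hβ.1 γ, ?_⟩
  rw [map_mul, map_mul, map_inv]
  rcases hβ.2 with h | h <;> simp [h]

/-- Γ_±(4p) is normal in SL(2, ℤ), as ±1 is central mod p; so all cusps have the width of infinity.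
-/
lemma conj_GammaPMReal (p : ℕ) (γ : SL(2, ℤ)) :
    ConjAct.toConjAct (mapGL ℝ γ)⁻¹ • GammaPMReal p = GammaPMReal p := by
  ext g
  rw [Subgroup.mem_pointwise_smul_iff_inv_smul_mem, ← ConjAct.toConjAct_inv, inv_inv,
    ConjAct.toConjAct_smul]
  constructor
  · rintro ⟨β, hβ, h⟩
    refine ⟨γ⁻¹ * β * γ, ?_, ?_⟩
    · simpa using conj_mem_GammaPM hβ γ⁻¹
    · rw [map_mul, map_mul, h, map_inv]
      group
  · rintro ⟨β, hβ, rfl⟩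
    exact ⟨γ * β * γ⁻¹, conj_mem_GammaPM hβ γ, by rw [map_mul, map_mul, map_inv]⟩

lemma T_zpow_mem_GammaPM (p : ℕ) (n : ℤ) : T ^ (4 * p * n) ∈ GammaPM p := by
  refine ⟨(T_zpow_mem_Gamma_four_iff _).mpr ⟨p * n, by ring⟩, Or.inl ?_⟩
  ext i j
  rw [map_apply_coe, coe_T_zpow]
  fin_cases i <;> fin_cases j <;> simp

lemma upperRightHom_intCast (n : ℤ) :
    Matrix.GeneralLinearGroup.upperRightHom (n : ℝ) = mapGL ℝ (T ^ n) := by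
  ext i j
  rw [mapGL_coe_matrix, map_apply_coe, coe_T_zpow]
  fin_cases i <;> fin_cases j <;> simp

lemma periods_GammaPMReal {p : ℕ} (hodd : Odd p) :
    (GammaPMReal p).periods = AddSubgroup.zmultiples ((4 * p : ℕ) : ℝ) := by
  ext x
  rw [AddSubgroup.mem_zmultiples_iff]
  constructor
  · intro hx
    have hx : Matrix.GeneralLinearGroup.upperRightHom x ∈ GammaPMReal p ∨
        -Matrix.GeneralLinearGroup.upperRightHom x ∈ GammaPMReal p := hx
    rcases hx with ⟨β, hβ, h⟩ | ⟨β, hβ, h⟩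
    · have h01 : ((β 0 1 : ℤ) : ℝ) = x := by
        have := congrArg (fun g : GL (Fin 2) ℝ => g 0 1) h
        simpa using this
      have h00 : ((β 0 0 : ℤ) : ℝ) = 1 := by
        have := congrArg (fun g : GL (Fin 2) ℝ => g 0 0) h
        simpa using this
      have h4 := (Gamma_four_iff.mp hβ.1).2.1
      have hp : (p : ℤ) ∣ β 0 1 := by
        obtain ⟨ε, -, hε⟩ := GammaPM_dvd hβ
        simpa using hε 0 1
      have hcop : IsCoprime (4 : ℤ) p := by
        rw [show (4 : ℤ) = 2 ^ 2 by norm_num]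
        exact (Int.isCoprime_two_left.mpr (by exact_mod_cast hodd)).pow_left
      obtain ⟨k, hk⟩ := hcop.mul_dvd h4 hp
      refine ⟨k, ?_⟩
      rw [← h01, hk]
      simp [mul_comm]
    -- There are no irregular periods: -1 is not congruent to 1 mod 4.
    · exfalso
      have h00 : ((β 0 0 : ℤ) : ℝ) = -1 := by
        have := congrArg (fun g : GL (Fin 2) ℝ => g 0 0) h
        simpa using this
      have h00 : β 0 0 = -1 := by exact_mod_cast h00
      have := (Gamma_four_iff.mp hβ.1).1
      rw [h00] at this
      omega
  · rintro ⟨n, rfl⟩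
    refine Subgroup.strictPeriods_le_periods _ ?_
    rw [Subgroup.mem_strictPeriods_iff]
    refine ⟨T ^ (4 * p * n), T_zpow_mem_GammaPM p n, ?_⟩
    rw [← upperRightHom_intCast]
    congr 1
    push_cast
    rw [zsmul_eq_mul, mul_comm]

lemma cuspWidth_eq {p : ℕ} (hp : p.Prime) (hodd : Odd p) (γ : SL(2, ℤ)) :
    cuspWidth p γ = ((4 * p : ℕ) : ℝ) := by
  have hfin := finiteIndex_GammaPM hp
  rw [cuspWidth, conj_GammaPMReal]
  have h := periods_GammaPMReal hodd
  have hpos : (0 : ℝ) < ((4 * p : ℕ) : ℝ) := by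
    have := hp.pos
    positivity
  rw [Subgroup.periods_eq_zmultiples_widthInfty, eq_comm, AddSubgroup.zmultiples_eq_zmultiples_iff
    (not_isOfFinAddOrder_of_isAddTorsionFree hpos.ne')] at h
  have h0 := (GammaPMReal p).widthInfty_nonneg
  rcases h with h | h
  · exact h.symm
  · linarith

/-! ### Orders of vanishing at the cusps -/

lemma baseForm_one_add_one {z : ℂ} (hz : 0 < z.im) :
    baseForm 1 (z + 1) = Complex.I * baseForm 1 z := by
  simp only [baseForm, Matrix.cons_val]
  rw [theta_add_one, phi_add_one hz]
  ring

lemma baseForm_one_add_four {z : ℂ} (hz : 0 < z.im) : baseForm 1 (z + 4) = baseForm 1 z := by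
  have h : ∀ w : ℂ, 0 < w.im → baseForm 1 (w + 2) = -baseForm 1 w := fun w hw => by
    rw [show w + 2 = w + 1 + 1 by ring, baseForm_one_add_one (by simpa using hw),
      baseForm_one_add_one hw, ← mul_assoc, Complex.I_mul_I, neg_one_mul]
  rw [show z + 4 = z + 2 + 2 by ring, h _ (by simpa using hz), h _ hz, neg_neg]

lemma tendsto_divShift {p : ℕ} (hp : 0 < p) (n : ℤ) :
    Tendsto (divShift p hp n) atImInfty atImInfty := by
  have hp' : (0 : ℝ) < p := by exact_mod_cast hp
  refine tendsto_comap_iff.mpr ?_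
  have h : (UpperHalfPlane.im ∘ divShift p hp n) = fun z : ℍ => z.im / p := by
    ext z
    rw [Function.comp_apply, ← coe_im, coe_divShift, Complex.div_natCast_im]
    simp
  rw [h]
  exact tendsto_comap.atTop_div_const hp'

lemma tendsto_baseFun_one_div : Tendsto
    (fun z : ℍ => baseFun 1 z / Complex.exp (Real.pi * Complex.I * z / 2)) atImInfty (𝓝 4) := by
  have h := (tendsto_theta.const_mul 2).mul tendsto_phi_div
  norm_num at h
  refine h.congr fun z => ?_
  simp only [baseFun, baseForm, Matrix.cons_val]
  ring

/-- The cusp function of `N((z + n) / p)`, up to a constant factor, has a simple zero. -/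
lemma analyticOrderAt_cuspFunction_baseForm {p : ℕ} (hp : 0 < p) (n : ℤ) {c : ℂ} (hc : c ≠ 0) :
    analyticOrderAt (cuspFunction ((4 * p : ℕ) : ℝ)
      (fun z : ℍ => c * baseForm 1 (((z : ℂ) + n) / p))) 0 = 1 := by
  have hp0 : (p : ℂ) ≠ 0 := by exact_mod_cast hp.ne'
  have hpos : (0 : ℝ) < ((4 * p : ℕ) : ℝ) := by positivity
  have him : ∀ {z : ℂ}, 0 < z.im → 0 < ((z + n) / p).im := fun {z} hz =>
    (divShift p hp n ⟨z, hz⟩).im_pos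
  have hper : Function.Periodic ((fun z : ℍ => c * baseForm 1 (((z : ℂ) + n) / p)) ∘ ofComplex)
      ((4 * p : ℕ) : ℝ) :=
    periodic_comp_ofComplex_of (f := fun z : ℂ => c * baseForm 1 ((z + n) / p)) fun z hz => by
      rw [← baseForm_one_add_four (him hz)]
      congr 2
      push_cast
      field_simp
      ring
  have hhol : MDiff (fun z : ℍ => c * baseForm 1 (((z : ℂ) + n) / p)) := by
    refine mdifferentiable_of_differentiableAt (f := fun z : ℂ => c * baseForm 1 ((z + n) / p))
      fun z hz => ?_
    have hd : DifferentiableAt ℂ (baseForm 1) ((z + n) / p) :=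
      ((differentiableAt_theta (him hz)).const_mul 2).mul (differentiableAt_phi (him hz))
    exact (hd.comp z ((differentiableAt_id.add_const _).div_const _)).const_mul c
  -- N is asymptotic to 4q^{1/4}; replacing z by (z+n)/p gives a constant times exp(2πiz/(4p)),
  -- exactly the local parameter.
  have hlim : Tendsto (fun z : ℍ => c * baseForm 1 (((z : ℂ) + n) / p) /
      Function.Periodic.qParam ((4 * p : ℕ) : ℝ) z) atImInfty
      (𝓝 (c * Complex.exp (Real.pi * Complex.I * (n / p) / 2) * 4)) := by
    have h := (tendsto_baseFun_one_div.comp (tendsto_divShift hp n)).const_mul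
      (c * Complex.exp (Real.pi * Complex.I * (n / p) / 2))
    refine h.congr fun z => ?_
    have he : Complex.exp (Real.pi * Complex.I * divShift p hp n z / 2) =
        Function.Periodic.qParam ((4 * p : ℕ) : ℝ) z *
          Complex.exp (Real.pi * Complex.I * (n / p) / 2) := by
      rw [Function.Periodic.qParam, ← Complex.exp_add, coe_divShift]
      congr 1
      push_cast
      field_simp
      ring
    have h1 := Complex.exp_ne_zero (Real.pi * Complex.I * (n / p) / 2)
    have h2 : Function.Periodic.qParam ((4 * p : ℕ) : ℝ) z ≠ 0 :=
      Function.Periodic.qParam_ne_zero _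
    simp only [Function.comp_apply]
    rw [he, baseFun, coe_divShift]
    field_simp
  obtain ⟨han, hval, hder⟩ := cuspFunction_of_tendsto_div_qParam hpos hper hhol hlim
  refine han.analyticOrderAt_eq_one_of_zero_deriv_ne_zero hval ?_
  rw [hder]
  exact mul_ne_zero (mul_ne_zero hc (Complex.exp_ne_zero _)) (by norm_num)

/-- The matrix `(1, 0; 0, p)`. -/
def diagMat (p : ℕ) : Matrix (Fin 2) (Fin 2) ℤ := !![1, 0; 0, (p : ℤ)]

lemma det_diagMat (p : ℕ) : (diagMat p).det = p := by simp [diagMat, Matrix.det_fin_two]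

lemma slashOne_mul (i : Fin 3) {α : Matrix (Fin 2) (Fin 2) ℤ} (hα : 0 < α.det)
    (γ : SL(2, ℤ)) :
    slashOne (baseForm i) (α * γ) = slashOne (baseForm i) α ∣[(1 : ℤ)] γ := by
  have h : 0 < (α * (γ : Matrix (Fin 2) (Fin 2) ℤ)).det := by
    rwa [Matrix.det_mul, γ.det_coe, mul_one]
  rw [slashOne_baseForm i _ h, slashOne_baseForm i _ hα, intGL_eq_mul α _ γ hα h rfl,
    SlashAction.slash_mul]
  rfl

lemma slash_eq_self_of_mem_V {p : ℕ} (hp : p.Prime) (hodd : Odd p) {g : ℍ → ℂ} (hg : g ∈ V p)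
    {β : SL(2, ℤ)} (hβ : β ∈ GammaPM p) : g ∣[(1 : ℤ)] β = g := by
  obtain ⟨G, rfl⟩ := exists_modularForm_of_mem_V hp hodd hg
  exact SlashInvariantFormClass.slash_action_eq G (mapGL ℝ β) ⟨β, hβ, rfl⟩

lemma slashOne_diagMat_slash {p : ℕ} (i : Fin 3) {h : SL(2, ℤ)} (hc : h 1 0 = 0) :
    ∃ (n : ℤ) (c : ℂ), c ≠ 0 ∧ slashOne (baseForm i) (diagMat p) ∣[(1 : ℤ)] h =
      fun z : ℍ => c * (p : ℂ)⁻¹ * baseForm i (((z : ℂ) + n) / p) := by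
  obtain ⟨n, hn⟩ := exists_eq_T_zpow_of_c_eq_zero hc
  have hdet := h.det_coe
  rw [Matrix.det_fin_two, hc, mul_zero, sub_zero] at hdet
  have hd : ((h 1 1 : ℤ) : ℂ) ≠ 0 := by
    rw [Int.cast_ne_zero]
    exact right_ne_zero_of_mul (hdet ▸ one_ne_zero)
  refine ⟨n, ((h 1 1 : ℤ) : ℂ)⁻¹, inv_ne_zero hd, ?_⟩
  ext z
  rw [SL_slash_apply, denom_apply, hc, hn, zpow_neg_one, slashOne, coe_T_zpow_smul_eq]
  simp [diagMat]
  ring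

/-- Every cusp is a simple zero of an element of `V`. -/
lemma exists_mem_V_vanishesToOrder_inr {p : ℕ} (hp : p.Prime) (hodd : Odd p)
    (c : CuspOrbits (GammaPMReal p)) : ∃ g ∈ V p, VanishesToOrder p g 1 (Sum.inr c) := by
  obtain ⟨⟨c₀, hc₀⟩, rfl⟩ := Quotient.exists_rep c
  obtain ⟨γ₀, rfl⟩ := isCusp_SL2Z_iff'.mp (IsCusp.mono (map_mapGL_le _) hc₀)
  have hpos : 0 < (diagMat p).det := by
    rw [det_diagMat]
    exact_mod_cast hp.pos
  -- Slashing by γ₀ turns g into a multiple of N(z/p). The division by p is essential: N itself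
  -- would vanish at infinity to order p in the parameter of width 4p.
  set g := slashOne (baseForm 1) (diagMat p * (γ₀⁻¹ : SL(2, ℤ))) with hg
  have hgV : g ∈ V p := by
    refine Submodule.subset_span ⟨1, _, Or.inr ?_, rfl⟩
    rw [Matrix.det_mul, (γ₀⁻¹).det_coe, mul_one, det_diagMat]
  refine ⟨g, hgV, fun γ hγ h => ?_⟩
  obtain ⟨⟨_, β, hβ, rfl⟩, h⟩ := Quotient.exact h
  have h : mapGL ℝ β • mapGL ℝ γ₀ • (OnePoint.infty : OnePoint ℝ) = mapGL ℝ γ • OnePoint.infty :=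
    congrArg Subtype.val h
  -- Any other representative γ of the cusp differs from γ₀ by β on the left and a stabilizer δ of
  -- infinity on the right. Up to sign δ is a translation, so it only changes N(z/p) into a multiple
  -- of N((z+n)/p).
  set δ := γ₀⁻¹ * β⁻¹ * γ with hδ
  have hδ0 : δ 1 0 = 0 := by
    have hfix : mapGL ℝ δ • (OnePoint.infty : OnePoint ℝ) = OnePoint.infty := by
      rw [hδ, map_mul, map_mul, mul_smul, mul_smul, ← h, map_inv, map_inv, inv_smul_smul,
        inv_smul_smul]
    rw [OnePoint.smul_infty_eq_self_iff] at hfix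
    simpa using hfix
  have hγ : γ = β * (γ₀ * δ) := by
    rw [hδ]
    group
  obtain ⟨n, u, hu, hslash⟩ := slashOne_diagMat_slash (p := p) 1 hδ0
  have hgγ : g ∣[(1 : ℤ)] γ =
      fun z : ℍ => u * (p : ℂ)⁻¹ * baseForm 1 (((z : ℂ) + n) / p) := by
    rw [hγ, SlashAction.slash_mul, slash_eq_self_of_mem_V hp hodd hgV hβ, SlashAction.slash_mul,
      hg, slashOne_mul 1 hpos, ← SlashAction.slash_mul _ γ₀⁻¹, inv_mul_cancel,
      SlashAction.slash_one, hslash]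
  rw [cuspWidth_eq hp hodd, hgγ]
  exact analyticOrderAt_cuspFunction_baseForm hp.pos n
    (mul_ne_zero hu (inv_ne_zero (by exact_mod_cast hp.ne_zero)))

end WeightOne

theorem theorem3p2 (p : ℕ) (hp : p.Prime) (hodd : Odd p) :
    -- the elements of `V` are modular forms of weight one on `Γ_±(4p)`
    (∀ g ∈ V p, ∃ G : ModularForm (GammaPMReal p) 1, ⇑G = g) ∧
    -- (1) the elements of `V` separate tangent vectors on `X_±(4p)`, cusps included
    (∀ x : Curve p, ∃ g ∈ V p, VanishesToOrder p g 1 x) ∧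
    -- `F` is well defined on `ℍ`
    ∃ hF : ∀ z, coords p z ≠ 0,
      -- (2) points with the same image under `F` are equivalent under `Γ_±(4p)`
      (∀ z z' : ℍ, F p hF z = F p hF z' → ∃ β ∈ GammaPM p, z' = β • z) ∧
      -- the elements of `V` separate the noncuspidal points of `X_±(4p)`
      (∀ z z' : ℍ, toOpenCurve p z ≠ toOpenCurve p z' → ∃ g ∈ V p, g z = 0 ∧ g z' ≠ 0) ∧
      -- `F` descends to an embedding of the noncuspidal part of `X_±(4p)`
      (∃ Fbar : OpenCurve p → ℙ ℂ (Idx p → ℂ), (∀ z, Fbar (toOpenCurve p z) = F p hF z) ∧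
        Function.Injective Fbar ∧ Topology.IsEmbedding Fbar) ∧
      IsHolomorphicImmersion (coords p) := by
  refine ⟨fun g hg => exists_modularForm_of_mem_V hp hodd hg, ?_, coords_ne_zero p, ?_,
    fun z z' h => exists_mem_V_separating hp hodd h,
    ⟨FQuot hp hodd (coords_ne_zero p), FQuot_toOpenCurve hp hodd _,
      injective_FQuot hp hodd _, isEmbedding_FQuot hp hodd _⟩,
    isHolomorphicImmersion_coords hp hodd⟩
  · rintro (y | c)
    · exact exists_mem_V_vanishesToOrder_inl p y
    · exact exists_mem_V_vanishesToOrder_inr hp hodd c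
  · intro z z' h
    obtain ⟨β, hβ, hz⟩ := toOpenCurve_eq_iff.mp ((F_eq_iff hp hodd _).mp h)
    exact ⟨β, hβ, hz.symm⟩
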